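/- **Logical language.** A set $\mathcal F$ of formulas closed under $\lnot$ and $\wedge$, a map $Atoms:\mathcal F\to 2^{\mathcal F}$ giving the atomic formulas occurring in a formula (so $Atoms(p)=\{p\}$ for every atom $p$, $Atoms(\lnot\phi)=Atoms(\phi)$, $Atoms(\phi\wedge\psi)=Atoms(\phi)\cup Atoms(\psi)$), and a set $\mathcal I$ of interpretations with a relation $\vDash_M$ for which $\lnot,\wedge$ behave classically. Formulas are *disjoint* if they share no atom, and $\Gamma\,\|\,\Delta$ means that every $\phi\in\Gamma$ is disjoint from every $\psi\in\Delta$. It is assumed that satisfiable $\Gamma,\Delta$ with $\Gamma\|\Delta$ are jointly satisfiable, and that no atom is unsatisfiable or tautological. $\Gamma\vDash_C\psi$ means that every interpretation satisfying $\Gamma$ satisfies $\psi$. $\phi=-\psi$ means $\phi=\lnot\psi$ or $\lnot\phi=\psi$. $Atoms(\mathcal F)=\bigcup_{\phi}Atoms(\phi)$. **Argumentation systems.** $AS$ consists of a satisfiable set $AX\subseteq\mathcal F$ of axioms, a set $R_d$ of defeasible rules $\phi_0,\dots,\phi_{m-1}\Rightarrow\phi_m$, a partial naming function $n:R_d\rightharpoonup\mathcal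 F$ and a total preorder $\le_r$ on $R_d$. Its strict rules are $\to\phi$ for $\phi\in AX$ and $\phi_0,\dots,\phi_{m-1}\to\phi_m$ whenever $\{\phi_0,\dots,\phi_{m-1}\}\vDash_C\phi_m$. Arguments are finite trees built from strict and defeasible rules; $a^C$ is the conclusion, $Sub(a)$ the set of sub-arguments (including $a$), $DR(a)$ the set of defeasible rules used in $a$; $a$ is defeasible if $DR(a)\ne\emptyset$. $Atoms(AS)$ is the set of atoms occurring in $R_d$, $AX$ or a value of $n$. $a$ *undercuts* $b$ if some $b'\in Sub(b)$ has a defeasible top rule $r$ with $n(r)$ defined and $a^C=-n(r)$. $a$ *gen-rebuts* $b$ if $b$ is defeasible and $a^C=\lnot\bigwedge\Gamma$ for some non-empty $\Gamma\subseteq Sub(b)^C$. $a\preceq b$ iff $DR(a)=DR(b)=\emptyset$ or $\exists r\in DR(a)\,\forall s\in DR(b):r\le_r s$. $a$ *attacks* $b$ if $a$ undercuts $b$, or $a$ gen-rebuts $b$ and not ($a\preceq b$ and $b\not\preceq a$). A set $S$ *supports* $b$ if $b$ has the form $b_0,\dots,b_m\to\phi$ (strict top rule) and $S=\{b_0,\dots,b_m\}$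 (possibly empty). An argument is *strict* if it is supported by a set all of whose elements are strict. **Labelings.** A labeling $L$ maps arguments to $\{IN,OUT,UNDEC\}$; $in(L)$ is the set of arguments labeled $IN$. $a$ is *legally IN* if all attackers of $a$ are $OUT$ and for each support $(S,c)$ with $a\in S$ and $a\preceq b$ for all $b\in S\setminus\{a\}$: $L(c)=IN$; or $L(c)=UNDEC$ and some $b\in S\setminus\{a\}$ is not $IN$; or $L(c)=OUT$ and $S\setminus\{a\}$ contains an $OUT$ argument or two distinct $UNDEC$ arguments. $a$ is *legally OUT* if an $IN$ argument attacks $a$, or there are supports $(S_0,b_0),\dots,(S_n,b_n)$ with $b_{i}\in S_{i+1}$ for $i<n$, $a\in S_0$, $S_0\setminus\{a\}\subseteq in(L)$, $b_n$ attacked by an $IN$ argument, all $b_i$ labeled $OUT$, $S_{i+1}\setminus\{b_i\}\subseteq in(L)$ for $i<n$, and $a\preceq d$ for all $d\in S_0\setminus\{a\}$. $L$ is *admissible* if every $IN$ argument is legally $IN$, an argument is $OUT$ iff it is legally $OUT$, and strict arguments are $IN$. $L$ is *preferred* if it is admissible with $in(L)$ inclusion-maximal among admissible labelings. The preferred conclusions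 are $\mathcal C_{pr}(AS)=\{\,\{a^C: a\in in(L)\} : L\text{ preferred}\,\}$. **Unions and restriction.** $AS_+$ is *a union* of $AS_1$ and $AS_2$ if its axioms, defeasible rules and naming function are the unions of those of $AS_1$ and $AS_2$ and its preference order is a total preorder on $R_{d_1}\cup R_{d_2}$ containing $\le_{r_1}$ and $\le_{r_2}$. $AS_1\|AS_2$ means $Atoms(AS_1)\|Atoms(AS_2)$. For $\mathcal C\subseteq 2^{\mathcal F}$ and a set $\Delta$ of atoms, $\mathcal C|_\Delta=\{\{\phi\in T: Atoms(\phi)\subseteq\Delta\}: T\in\mathcal C\}$. **Theorem.** For every such logical language, the preferred semantics of Deductive ASPIC$^{\ominus}$ satisfies: 1. *(Non-interference)* For all $AS_1,AS_2$ with $AS_1\|AS_2$, every union $AS_+$ of them and $i\in\{1,2\}$: $\mathcal C_{pr}(AS_i)|_{Atoms(AS_i)}=\mathcal C_{pr}(AS_+)|_{Atoms(AS_i)}$. 2. *(Crash-resistance)* There is no contaminating $AS_1$, where $AS_1$ is contaminating if $Atoms(AS_1)\subsetneq Atoms(\mathcal F)$ and $\mathcal C_{pr}(AS_1)=\mathcal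 C_{pr}(AS_+)$ for every $AS_2$ with $AS_1\|AS_2$ and every union $AS_+$ of $AS_1$ and $AS_2$. -/

import Mathlib

namespace DeductiveASPIC

universe u v

/-! ### Joint support bipolar argumentation frameworks -/

/-- A JSBAF with set of arguments `A`: attacks, supports and a total preference (pre)order. -/
structure JSBAF (A : Type u) where
  /-- `attacks a b`: the argument `a` attacks the argument `b` -/
  attacks : A → A → Prop
  /-- `supports S b`: the set of arguments `S` supports the argument `b` -/
  supports : Set A → A → Prop
  /-- `pref a b`: the argument `b` is at least as strong as the argument `a` -/
  pref : A → A → Prop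
  pref_total : ∀ a b, pref a b ∨ pref b a
  pref_trans : ∀ a b c, pref a b → pref b c → pref a c

/-- The three labels for arguments. -/
inductive Label where
  | IN : Label
  | OUT : Label
  | UNDEC : Label

/-- The set of arguments that a labeling accepts. -/
def inSet {A : Type u} (L : A → Label) : Set A := {a | L a = Label.IN}

namespace JSBAF

variable {A : Type u} (J : JSBAF A)

/-- Strict arguments: supported by a (possibly empty) set of strict arguments. -/
inductive IsStrict : A → Prop where
  | intro (S : Set A) (a : A) (h : J.supports S a) (hS : ∀ b ∈ S, IsStrict b) : IsStrict a

/-- `(S 0, b 0), …, (S n, b n)` is a support chain (values at indices above `n` are irrelevant). -/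
def IsSupportChain (n : ℕ) (S : ℕ → Set A) (b : ℕ → A) : Prop :=
  (∀ i ≤ n, J.supports (S i) (b i)) ∧ ∀ i < n, b i ∈ S (i + 1)

/-- `a` is legally IN with respect to the labeling `L`. -/
def LegallyIn (L : A → Label) (a : A) : Prop :=
  (∀ b, J.attacks b a → L b = Label.OUT) ∧
  ∀ (S : Set A) (c : A), J.supports S c → a ∈ S → (∀ b ∈ S \ {a}, J.pref a b) →
    L c = Label.IN ∨
    (L c = Label.UNDEC ∧ ∃ b ∈ S \ {a}, L b = Label.OUT ∨ L b = Label.UNDEC) ∨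
    (L c = Label.OUT ∧
      ((∃ b ∈ S \ {a}, L b = Label.OUT) ∨
        ∃ b₁ ∈ S \ {a}, ∃ b₂ ∈ S \ {a},
          b₁ ≠ b₂ ∧ L b₁ = Label.UNDEC ∧ L b₂ = Label.UNDEC))

/-- `a` is legally OUT with respect to the labeling `L`. -/
def LegallyOut (L : A → Label) (a : A) : Prop :=
  (∃ b, J.attacks b a ∧ L b = Label.IN) ∨
  ∃ (n : ℕ) (S : ℕ → Set A) (b : ℕ → A), J.IsSupportChain n S b ∧
    a ∈ S 0 ∧ (∀ d ∈ S 0 \ {a}, L d = Label.IN) ∧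
    (∃ c, J.attacks c (b n) ∧ L c = Label.IN) ∧
    (∀ i ≤ n, L (b i) = Label.OUT) ∧
    (∀ i < n, ∀ d ∈ S (i + 1) \ {b i}, L d = Label.IN) ∧
    (∀ d ∈ S 0 \ {a}, J.pref a d)

/-- Admissible labelings. -/
def Admissible (L : A → Label) : Prop :=
  (∀ a, L a = Label.IN → J.LegallyIn L a) ∧
  (∀ a, L a = Label.OUT ↔ J.LegallyOut L a) ∧
  (∀ a, J.IsStrict a → L a = Label.IN)

/-- Preferred labelings: admissible labelings whose set of accepted arguments is maximal. -/
def Preferred (L : A → Label) : Prop :=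
  J.Admissible L ∧ ∀ L' : A → Label, J.Admissible L' → inSet L ⊆ inSet L' → inSet L' = inSet L

end JSBAF

/-! ### The underlying logical language -/

/-- A logical language with formulas `F` and interpretations `I`. `atoms φ` is the set of atomic
formulas occurring in `φ`. -/
structure LogicalLanguage (F : Type u) (I : Type v) where
  atoms : F → Set F
  neg : F → F
  conj : F → F → F
  models : I → F → Prop
  /-- atomic formulas are the formulas in the range of `atoms`; such a formula is its only atom -/
  atoms_atom : ∀ φ, ∀ p ∈ atoms φ, atoms p = {p}
  atoms_neg : ∀ φ, atoms (neg φ) = atoms φ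
  atoms_conj : ∀ φ ψ, atoms (conj φ ψ) = atoms φ ∪ atoms ψ
  models_neg : ∀ i φ, models i (neg φ) ↔ ¬ models i φ
  models_conj : ∀ i φ ψ, models i (conj φ ψ) ↔ models i φ ∧ models i ψ
  /-- syntactically disjoint satisfiable sets of formulas are jointly satisfiable -/
  joint_sat : ∀ Γ Δ : Set F, (∀ φ ∈ Γ, ∀ ψ ∈ Δ, atoms φ ∩ atoms ψ = ∅) →
    (∃ i, ∀ φ ∈ Γ, models i φ) → (∃ i, ∀ ψ ∈ Δ, models i ψ) →
    ∃ i, (∀ φ ∈ Γ, models i φ) ∧ ∀ ψ ∈ Δ, models i ψ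
  /-- no atom is unsatisfiable or tautological -/
  atoms_contingent : ∀ φ, ∀ p ∈ atoms φ, (∃ i, models i p) ∧ ∃ i, models i (neg p)

namespace LogicalLanguage

variable {F : Type u} {I : Type v} (𝓛 : LogicalLanguage F I)

/-- Syntactic disjointness of sets of formulas. -/
def SynDisjoint (Γ Δ : Set F) : Prop := ∀ φ ∈ Γ, ∀ ψ ∈ Δ, 𝓛.atoms φ ∩ 𝓛.atoms ψ = ∅

/-- All atoms of the language. -/
def allAtoms : Set F := ⋃ φ : F, 𝓛.atoms φ

def Satisfiable (Γ : Set F) : Prop := ∃ i, ∀ φ ∈ Γ, 𝓛.models i φ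

/-- The consequence relation. -/
def Entails (Γ : Set F) (ψ : F) : Prop := ∀ i, (∀ φ ∈ Γ, 𝓛.models i φ) → 𝓛.models i ψ

/-- `φ = -ψ`. -/
def Opposite (φ ψ : F) : Prop := φ = 𝓛.neg ψ ∨ 𝓛.neg φ = ψ

/-- `χ` is the conjunction `φ₀ ∧ … ∧ φₘ` of the elements of the finite non-empty set `Γ`, listed
without repetition in some order and bracketed to the left. -/
def IsBigConj (Γ : Set F) (χ : F) : Prop :=
  ∃ (φ : F) (l : List F), (φ :: l).Nodup ∧ {ψ | ψ ∈ φ :: l} = Γ ∧ χ = l.foldl 𝓛.conj φ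

/-- The restriction of a set of sets of formulas to a set `Δ` of atoms. -/
def restrict (C : Set (Set F)) (Δ : Set F) : Set (Set F) :=
  {T | ∃ T' ∈ C, T = {φ ∈ T' | 𝓛.atoms φ ⊆ Δ}}

end LogicalLanguage

/-! ### Rules, arguments and argumentation systems -/

/-- The rule with the given list of premises and the given conclusion. -/
structure Rule (F : Type u) where
  premises : List F
  concl : F

/-- Proof trees `a₀, …, aₙ₋₁ → φ` and `a₀, …, aₙ₋₁ ⇒ φ`. -/
inductive Arg (F : Type u) where
  | strict (n : ℕ) (sub : Fin n → Arg F) (φ : F) : Arg F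
  | defeasible (n : ℕ) (sub : Fin n → Arg F) (φ : F) : Arg F

namespace Arg

variable {F : Type u}

def concl : Arg F → F
  | strict _ _ φ => φ
  | defeasible _ _ φ => φ

/-- The set of sub-arguments, including the argument itself. -/
def subs : Arg F → Set (Arg F)
  | strict n s φ => insert (strict n s φ) (⋃ i, subs (s i))
  | defeasible n s φ => insert (defeasible n s φ) (⋃ i, subs (s i))

/-- The defeasible rules used in an argument. -/
def defRules : Arg F → Set (Rule F)
  | strict _ s _ => ⋃ i, defRules (s i)
  | defeasible _ s φ => insert ⟨List.ofFn fun i => (s i).concl, φ⟩ (⋃ i, defRules (s i))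

theorem defRules_finite (a : Arg F) : a.defRules.Finite := by
  induction a with
  | strict n s φ ih => exact Set.finite_iUnion ih
  | defeasible n s φ ih => exact (Set.finite_iUnion ih).insert _

end Arg

/-- An argumentation system over the language `𝓛`. Its strict rules are determined by the set `AX`
of axioms, see `ArgSystem.strictRules`. -/
structure ArgSystem {F : Type u} {I : Type v} (𝓛 : LogicalLanguage F I) where
  AX : Set F
  AX_sat : 𝓛.Satisfiable AX
  /-- the defeasible rules -/
  Rd : Set (Rule F)
  /-- the naming function, a partial function on `Rd` -/
  name : Rule F → Option F
  name_dom : ∀ r φ, name r = some φ → r ∈ Rd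
  /-- the preference order, a total preorder on `Rd` -/
  le : Rule F → Rule F → Prop
  le_dom : ∀ r s, le r s → r ∈ Rd ∧ s ∈ Rd
  le_total : ∀ r ∈ Rd, ∀ s ∈ Rd, le r s ∨ le s r
  le_trans : ∀ r s t, le r s → le s t → le r t

namespace ArgSystem

variable {F : Type u} {I : Type v} {𝓛 : LogicalLanguage F I} (AS : ArgSystem 𝓛)

/-- The strict rules: axiomatic rules `→ φ` and all rules given by the consequence relation. -/
def strictRules : Set (Rule F) :=
  {r | r.premises = [] ∧ r.concl ∈ AS.AX} ∪ {r | 𝓛.Entails {φ | φ ∈ r.premises} r.concl}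

/-- The proof tree is built from the rules of `AS`. -/
def IsArg : Arg F → Prop
  | .strict _ s φ =>
      (∀ i, IsArg (s i)) ∧ (⟨List.ofFn fun i => (s i).concl, φ⟩ : Rule F) ∈ AS.strictRules
  | .defeasible _ s φ =>
      (∀ i, IsArg (s i)) ∧ (⟨List.ofFn fun i => (s i).concl, φ⟩ : Rule F) ∈ AS.Rd

/-- The arguments that can be constructed based on `AS`. -/
abbrev Argument : Type u := {a : Arg F // AS.IsArg a}

theorem defRules_subset (a : Arg F) (h : AS.IsArg a) : a.defRules ⊆ AS.Rd := by
  induction a with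
  | strict n s φ ih => exact Set.iUnion_subset fun i => ih i (h.1 i)
  | defeasible n s φ ih =>
    exact Set.insert_subset h.2 (Set.iUnion_subset fun i => ih i (h.1 i))

/-- `a` undercuts `b`: the conclusion of `a` is opposite to the name of a defeasible rule that is
the top rule of a sub-argument of `b`. -/
def Undercuts (a b : AS.Argument) : Prop :=
  ∃ (n : ℕ) (s : Fin n → Arg F) (φ ν : F), Arg.defeasible n s φ ∈ b.1.subs ∧
    AS.name ⟨List.ofFn fun i => (s i).concl, φ⟩ = some ν ∧ 𝓛.Opposite a.1.concl ν

/-- `a` gen-rebuts `b`: `b` is defeasible and the conclusion of `a` is `¬ ⋀ Γ` for some set `Γ` of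
conclusions of sub-arguments of `b`. -/
def GenRebuts (a b : AS.Argument) : Prop :=
  b.1.defRules.Nonempty ∧
  ∃ Γ ⊆ Arg.concl '' b.1.subs, ∃ χ, 𝓛.IsBigConj Γ χ ∧ a.1.concl = 𝓛.neg χ

/-- The elitist weakest link lifting of the preferences to arguments. -/
def ewl (a b : AS.Argument) : Prop :=
  (a.1.defRules = ∅ ∧ b.1.defRules = ∅) ∨ ∃ r ∈ a.1.defRules, ∀ s ∈ b.1.defRules, AS.le r s

/-- `a` defeats `b`: it undercuts `b`, or gen-rebuts `b` without being strictly weaker. -/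
def Defeats (a b : AS.Argument) : Prop :=
  AS.Undercuts a b ∨ (AS.GenRebuts a b ∧ ¬ (AS.ewl a b ∧ ¬ AS.ewl b a))

theorem exists_weakest (a : AS.Argument) (h : a.1.defRules.Nonempty) :
    ∃ r ∈ a.1.defRules, ∀ s ∈ a.1.defRules, AS.le r s := by
  have key : ∀ T : Set (Rule F), T.Finite → T ⊆ AS.Rd → T.Nonempty →
      ∃ r ∈ T, ∀ s ∈ T, AS.le r s := by
    intro T hT
    induction T, hT using Set.Finite.induction_on with
    | empty => intro _ h; exact absurd h (by simp)
    | @insert x T _ _ ih =>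
      intro hsub _
      have hx : x ∈ AS.Rd := hsub (Set.mem_insert _ _)
      have hxx : AS.le x x := (AS.le_total x hx x hx).elim id id
      rcases T.eq_empty_or_nonempty with rfl | hne
      · exact ⟨x, Set.mem_insert _ _, by simpa using hxx⟩
      · obtain ⟨r, hr, hmin⟩ := ih (fun y hy => hsub (Set.mem_insert_of_mem _ hy)) hne
        rcases AS.le_total x hx r (hsub (Set.mem_insert_of_mem _ hr)) with hle | hle
        · refine ⟨x, Set.mem_insert _ _, ?_⟩
          rintro s (rfl | hs)
          · exact hxx
          · exact AS.le_trans _ _ _ hle (hmin s hs)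
        · refine ⟨r, Set.mem_insert_of_mem _ hr, ?_⟩
          rintro s (rfl | hs)
          · exact hle
          · exact hmin s hs
  exact key _ a.1.defRules_finite (AS.defRules_subset a.1 a.2) h

theorem ewl_total (a b : AS.Argument) : AS.ewl a b ∨ AS.ewl b a := by
  rcases a.1.defRules.eq_empty_or_nonempty with ha | ha
  · rcases b.1.defRules.eq_empty_or_nonempty with hb | ⟨r, hr⟩
    · exact Or.inl (Or.inl ⟨ha, hb⟩)
    · exact Or.inr (Or.inr ⟨r, hr, by simp [ha]⟩)
  · obtain ⟨r, hr, hmin⟩ := AS.exists_weakest a ha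
    rcases b.1.defRules.eq_empty_or_nonempty with hb | hb
    · exact Or.inl (Or.inr ⟨r, hr, by simp [hb]⟩)
    · obtain ⟨s, hs, hmin'⟩ := AS.exists_weakest b hb
      rcases AS.le_total r (AS.defRules_subset _ a.2 hr) s (AS.defRules_subset _ b.2 hs) with h | h
      · exact Or.inl (Or.inr ⟨r, hr, fun t ht => AS.le_trans _ _ _ h (hmin' t ht)⟩)
      · exact Or.inr (Or.inr ⟨s, hs, fun t ht => AS.le_trans _ _ _ h (hmin t ht)⟩)

theorem ewl_trans (a b c : AS.Argument) (hab : AS.ewl a b) (hbc : AS.ewl b c) : AS.ewl a c := by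
  rcases hbc with ⟨hb, hc⟩ | ⟨s, hs, hsc⟩
  · rcases hab with ⟨ha, _⟩ | ⟨r, hr, _⟩
    · exact Or.inl ⟨ha, hc⟩
    · exact Or.inr ⟨r, hr, by simp [hc]⟩
  · rcases hab with ⟨_, hb⟩ | ⟨r, hr, hrb⟩
    · simp [hb] at hs
    · exact Or.inr ⟨r, hr, fun t ht => AS.le_trans _ _ _ (hrb s hs) (hsc t ht)⟩

/-- The JSBAF corresponding to an argumentation system. -/
def toJSBAF : JSBAF AS.Argument where
  attacks := AS.Defeats
  supports S b := ∃ (n : ℕ) (s : Fin n → Arg F) (φ : F),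
    b.1 = Arg.strict n s φ ∧ S = {x | ∃ i, x.1 = s i}
  pref := AS.ewl
  pref_total := AS.ewl_total
  pref_trans := AS.ewl_trans

/-- The preferred extensions of an argumentation system. -/
def preferredExtensions : Set (Set AS.Argument) :=
  {E | ∃ L, AS.toJSBAF.Preferred L ∧ E = inSet L}

/-- The atoms occurring in a rule. -/
def ruleAtoms (𝓛 : LogicalLanguage F I) (r : Rule F) : Set F :=
  (⋃ φ ∈ r.premises, 𝓛.atoms φ) ∪ 𝓛.atoms r.concl

/-- The atoms occurring in the defeasible rules, the axioms and the names of the rules. -/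
def atoms : Set F :=
  (⋃ r ∈ AS.Rd, ruleAtoms 𝓛 r) ∪ (⋃ φ ∈ AS.AX, 𝓛.atoms φ) ∪
    ⋃ (r : Rule F) (φ : F) (_ : AS.name r = some φ), 𝓛.atoms φ

/-- Syntactic disjointness of argumentation systems. -/
def SynDisjoint (AS₁ AS₂ : ArgSystem 𝓛) : Prop := 𝓛.SynDisjoint AS₁.atoms AS₂.atoms

/-- `AS` is a union of `AS₁` and `AS₂`. -/
structure IsUnion (AS₁ AS₂ AS : ArgSystem 𝓛) : Prop where
  AX_eq : AS.AX = AS₁.AX ∪ AS₂.AX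
  Rd_eq : AS.Rd = AS₁.Rd ∪ AS₂.Rd
  name_iff : ∀ r φ, AS.name r = some φ ↔ AS₁.name r = some φ ∨ AS₂.name r = some φ
  le_left : ∀ r s, AS₁.le r s → AS.le r s
  le_right : ∀ r s, AS₂.le r s → AS.le r s

end ArgSystem

/-! ### Semantics and postulates -/

/-- A semantics assigns to each argumentation system over `𝓛` a set of extensions. -/
abbrev ASSemantics {F : Type u} {I : Type v} (𝓛 : LogicalLanguage F I) : Type u :=
  (AS : ArgSystem 𝓛) → Set (Set AS.Argument)

namespace ASSemantics

variable {F : Type u} {I : Type v} {𝓛 : LogicalLanguage F I} (σ : ASSemantics 𝓛)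

/-- The conclusions of `AS` under the semantics `σ`, a set of sets of formulas. -/
def conclusions (AS : ArgSystem 𝓛) : Set (Set F) :=
  {T | ∃ E ∈ σ AS, T = (fun a : AS.Argument => a.1.concl) '' E}

def NonInterference : Prop :=
  ∀ AS₁ AS₂ AS : ArgSystem 𝓛, AS₁.SynDisjoint AS₂ → ArgSystem.IsUnion AS₁ AS₂ AS →
    𝓛.restrict (σ.conclusions AS₁) AS₁.atoms = 𝓛.restrict (σ.conclusions AS) AS₁.atoms ∧
    𝓛.restrict (σ.conclusions AS₂) AS₂.atoms = 𝓛.restrict (σ.conclusions AS) AS₂.atoms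

def Contaminating (AS₁ : ArgSystem 𝓛) : Prop :=
  AS₁.atoms ⊂ 𝓛.allAtoms ∧
  ∀ AS₂ AS : ArgSystem 𝓛, AS₁.SynDisjoint AS₂ → ArgSystem.IsUnion AS₁ AS₂ AS →
    σ.conclusions AS₁ = σ.conclusions AS

def CrashResistance : Prop := ¬ ∃ AS₁ : ArgSystem 𝓛, σ.Contaminating AS₁

end ASSemantics

/-- Preferred semantics. -/
def preferredSemantics {F : Type u} {I : Type v} (𝓛 : LogicalLanguage F I) : ASSemantics 𝓛 :=
  fun AS => AS.preferredExtensions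

end DeductiveASPIC

/-! Labelings and preferences can be eliminated. An argument matters only through the defeasible
rules it uses, and a preferred labeling only through the set `R` of rules in its accepted arguments.
Undercuts depend on the target's rules. A gen-rebut may fail because the attacker is weaker, but
strict inferences can merge the target with the attacker; the attacker's rules are then among those
of the merged argument, so the attack on it succeeds, and the support clauses carry the rejection
back to the original target. Hence being OUT means being undercut by `R` or inconsistent with `R`,
and `conclusions_preferredSemantics` describes the preferred conclusions by maximal `Good` sets:
grounded, consistent, not undercutting themselves, and undercutting or inconsistent with every
grounded set that undercuts them. Consistency is finite satisfiability, since arguments are finite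
and the logic need not be compact.

In a union of disjoint systems, a consistent derivation splits: joint satisfiability lets the
premises of the other system be dropped (`Entails.of_union`, `IsUnion.finEntails`). Good sets of the
union then decompose into good sets of the components (`Good.union_isUnion`, `Good.inter_isUnion`),
which gives non-interference. The obstacle is a rule common to both systems, whose name may come
from either. Its conclusion has no atoms, hence is tautological if satisfiable; such rules derive
nothing new and are discarded beforehand (`conclusions_preferredSemantics_sdiff_tautRules`).

For crash-resistance, a contaminating system would be unaffected by a new axiom `p` or `¬p` over a
foreign atom, so both would lie in every preferred conclusion set. But such sets exist by Zorn's
lemma and are consistent. -/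

namespace DeductiveASPIC

universe u v

/-! ### Finite satisfiability and finitary consequence -/

namespace LogicalLanguage

variable {F : Type u} {I : Type v} (𝓛 : LogicalLanguage F I)

/-- Every finite subset of `Γ` is satisfiable. -/
def FinSat (Γ : Set F) : Prop := ∀ Δ ⊆ Γ, Δ.Finite → 𝓛.Satisfiable Δ

/-- The formula `φ` follows from a finite subset of `Γ`. -/
def FinEntails (Γ : Set F) (φ : F) : Prop := ∃ Δ ⊆ Γ, Δ.Finite ∧ 𝓛.Entails Δ φ

variable {𝓛}

theorem Entails.mono {Γ Δ : Set F} {φ : F} (h : 𝓛.Entails Γ φ) (hΓ : Γ ⊆ Δ) : 𝓛.Entails Δ φ :=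
  fun i hi => h i fun ψ hψ => hi ψ (hΓ hψ)

theorem Entails.of_mem {Γ : Set F} {φ : F} (h : φ ∈ Γ) : 𝓛.Entails Γ φ := fun _ hi => hi φ h

theorem FinSat.mono {Γ Δ : Set F} (h : 𝓛.FinSat Δ) (hΓ : Γ ⊆ Δ) : 𝓛.FinSat Γ :=
  fun Θ hΘ hfin => h Θ (hΘ.trans hΓ) hfin

theorem Satisfiable.finSat {Γ : Set F} (h : 𝓛.Satisfiable Γ) : 𝓛.FinSat Γ :=
  fun _ hΔ _ => h.imp fun _ hi φ hφ => hi φ (hΔ hφ)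

theorem FinEntails.mono {Γ Δ : Set F} {φ : F} (h : 𝓛.FinEntails Γ φ) (hΓ : Γ ⊆ Δ) :
    𝓛.FinEntails Δ φ := by
  obtain ⟨Θ, hΘ, hfin, hent⟩ := h
  exact ⟨Θ, hΘ.trans hΓ, hfin, hent⟩

theorem FinEntails.of_mem {Γ : Set F} {φ : F} (h : φ ∈ Γ) : 𝓛.FinEntails Γ φ :=
  ⟨{φ}, by simpa using h, Set.finite_singleton _, .of_mem rfl⟩

/-- A finite set of finitary consequences of `Γ` follows from a single finite subset of `Γ`. -/
theorem exists_finite_entails {Γ Δ : Set F} (hΔ : Δ.Finite) (h : ∀ φ ∈ Δ, 𝓛.FinEntails Γ φ) :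
    ∃ Θ ⊆ Γ, Θ.Finite ∧ ∀ φ ∈ Δ, 𝓛.Entails Θ φ := by
  choose! Θ hΘ hfin hent using h
  exact ⟨⋃ φ ∈ Δ, Θ φ, Set.iUnion₂_subset hΘ, hΔ.biUnion hfin,
    fun φ hφ => (hent φ hφ).mono (Set.subset_biUnion_of_mem (u := Θ) hφ)⟩

theorem FinEntails.trans {Γ Δ : Set F} {φ : F} (hΔ : Δ.Finite)
    (h : ∀ ψ ∈ Δ, 𝓛.FinEntails Γ ψ) (hφ : 𝓛.Entails Δ φ) : 𝓛.FinEntails Γ φ := by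
  obtain ⟨Θ, hΘ, hfin, hent⟩ := exists_finite_entails hΔ h
  exact ⟨Θ, hΘ, hfin, fun i hi => hφ i fun ψ hψ => hent ψ hψ i hi⟩

theorem FinSat.of_finEntails {Γ Δ : Set F} (hΓ : 𝓛.FinSat Γ)
    (h : ∀ φ ∈ Δ, 𝓛.FinEntails Γ φ) : 𝓛.FinSat Δ := by
  intro Δ' hΔ' hfin
  obtain ⟨Θ, hΘ, hΘfin, hent⟩ := exists_finite_entails hfin fun φ hφ => h φ (hΔ' hφ)
  obtain ⟨i, hi⟩ := hΓ Θ hΘ hΘfin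
  exact ⟨i, fun φ hφ => hent φ hφ i hi⟩

theorem Opposite.atoms_eq {φ ψ : F} (h : 𝓛.Opposite φ ψ) : 𝓛.atoms φ = 𝓛.atoms ψ := by
  rcases h with rfl | rfl
  · exact 𝓛.atoms_neg ψ
  · exact (𝓛.atoms_neg φ).symm

theorem models_foldl_conj (i : I) (l : List F) (φ : F) :
    𝓛.models i (l.foldl 𝓛.conj φ) ↔ ∀ ψ ∈ φ :: l, 𝓛.models i ψ := by
  induction l generalizing φ with
  | nil => simp
  | cons a l ih =>
    rw [List.foldl_cons, ih]
    simp [𝓛.models_conj, and_assoc]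

theorem IsBigConj.models_iff {Γ : Set F} {χ : F} (h : 𝓛.IsBigConj Γ χ) (i : I) :
    𝓛.models i χ ↔ ∀ ψ ∈ Γ, 𝓛.models i ψ := by
  obtain ⟨φ, l, -, rfl, rfl⟩ := h
  exact models_foldl_conj i l φ

theorem IsBigConj.finite {Γ : Set F} {χ : F} (h : 𝓛.IsBigConj Γ χ) : Γ.Finite := by
  obtain ⟨φ, l, -, rfl, rfl⟩ := h
  exact List.finite_toSet _

theorem exists_isBigConj {Γ : Set F} (hΓ : Γ.Finite) (hne : Γ.Nonempty) :
    ∃ χ, 𝓛.IsBigConj Γ χ := by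
  have hmem : ∀ ψ, ψ ∈ hΓ.toFinset.toList ↔ ψ ∈ Γ := fun ψ => by simp
  have hnodup : hΓ.toFinset.toList.Nodup := hΓ.toFinset.nodup_toList
  cases hl : hΓ.toFinset.toList with
  | nil =>
    obtain ⟨ψ, hψ⟩ := hne
    have := (hmem ψ).2 hψ
    simp [hl] at this
  | cons φ l =>
    rw [hl] at hmem hnodup
    exact ⟨_, φ, l, hnodup, Set.ext hmem, rfl⟩

/-- A set containing all of `Γ` together with `¬ ⋀ Γ` is not finitely satisfiable. -/
theorem IsBigConj.not_finSat {Γ Δ : Set F} {χ : F} (h : 𝓛.IsBigConj Γ χ) (hΓ : Γ ⊆ Δ)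
    (hχ : 𝓛.neg χ ∈ Δ) : ¬ 𝓛.FinSat Δ := by
  intro hsat
  obtain ⟨i, hi⟩ := hsat (insert (𝓛.neg χ) Γ) (Set.insert_subset hχ hΓ) (h.finite.insert _)
  exact (𝓛.models_neg i χ).1 (hi _ (Set.mem_insert _ _))
    ((h.models_iff i).2 fun ψ hψ => hi ψ (Set.mem_insert_of_mem _ hψ))

/-- Formulas without atoms are tautological if they are satisfiable. -/
theorem tautology_of_atoms_eq_empty {φ : F} (h : 𝓛.atoms φ = ∅) (hφ : ∃ i, 𝓛.models i φ) (i : I) :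
    𝓛.models i φ := by
  by_contra hi
  -- Without atoms, `φ` and `¬φ` count as disjoint, so they would be jointly satisfiable.
  obtain ⟨j, h₁, h₂⟩ := 𝓛.joint_sat {φ} {𝓛.neg φ} (by simp [h]) (by simpa using hφ)
    ⟨i, by simpa [𝓛.models_neg] using hi⟩
  exact (𝓛.models_neg j φ).1 (h₂ _ rfl) (h₁ _ rfl)

/-- Premises that are syntactically disjoint from the conclusion and from the other premises
can be dropped. -/
theorem Entails.of_union {Γ Δ : Set F} {φ : F} (h : 𝓛.Entails (Γ ∪ Δ) φ)
    (hΔ : 𝓛.Satisfiable Δ) (hdisj : 𝓛.SynDisjoint (insert φ Γ) Δ) : 𝓛.Entails Γ φ := by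
  intro i hi
  by_contra hφ
  obtain ⟨j, h₁, h₂⟩ := 𝓛.joint_sat (insert (𝓛.neg φ) Γ) Δ
    (by
      rintro ψ (rfl | hψ) θ hθ
      · rw [𝓛.atoms_neg]
        exact hdisj φ (Set.mem_insert _ _) θ hθ
      · exact hdisj ψ (Set.mem_insert_of_mem _ hψ) θ hθ)
    ⟨i, by
      rintro ψ (rfl | hψ)
      · exact (𝓛.models_neg i φ).2 hφ
      · exact hi ψ hψ⟩ hΔ
  refine (𝓛.models_neg j φ).1 (h₁ _ (Set.mem_insert _ _)) (h j ?_)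
  rintro ψ (hψ | hψ)
  · exact h₁ ψ (Set.mem_insert_of_mem _ hψ)
  · exact h₂ ψ hψ

end LogicalLanguage

/-! ### Derivability from sets of defeasible rules -/

namespace ArgSystem

open LogicalLanguage

variable {F : Type u} {I : Type v} {𝓛 : LogicalLanguage F I} (AS : ArgSystem 𝓛)

/-- Derivability from the axioms by finitary consequence and the defeasible rules in `R`. -/
inductive Der (R : Set (Rule F)) : F → Prop where
  | ax {φ : F} (h : φ ∈ AS.AX) : Der R φ
  | entails {φ : F} (Γ : Set F) (hfin : Γ.Finite) (hΓ : ∀ ψ ∈ Γ, Der R ψ) (h : 𝓛.Entails Γ φ) :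
      Der R φ
  | rule (r : Rule F) (hr : r ∈ R) (h : ∀ ψ ∈ r.premises, Der R ψ) : Der R r.concl

/-- All rules in `R` are applicable on the basis of `R`. -/
def Grounded (R : Set (Rule F)) : Prop := ∀ r ∈ R, ∀ φ ∈ r.premises, AS.Der R φ

/-- The axioms and the conclusions of the applicable rules of `R`. -/
def base (R : Set (Rule F)) : Set F :=
  AS.AX ∪ {φ | ∃ r ∈ R, (∀ ψ ∈ r.premises, AS.Der R ψ) ∧ r.concl = φ}

/-- A formula opposite to the name of `r` is derivable from `R`. -/
def RuleUndercut (R : Set (Rule F)) (r : Rule F) : Prop :=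
  ∃ ν, AS.name r = some ν ∧ ∃ φ, AS.Der R φ ∧ 𝓛.Opposite φ ν

variable {AS}

theorem Der.mono {R R' : Set (Rule F)} (hR : R ⊆ R') {φ : F} (h : AS.Der R φ) : AS.Der R' φ := by
  induction h with
  | ax h => exact .ax h
  | entails Γ hfin _ h ih => exact .entails Γ hfin ih h
  | rule r hr _ ih => exact .rule r (hR hr) ih

theorem Der.base {R : Set (Rule F)} {φ : F} (h : φ ∈ AS.base R) : AS.Der R φ := by
  rcases h with h | ⟨r, hr, h, rfl⟩
  · exact .ax h
  · exact .rule r hr h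

/-- A defeasible step contributes only its conclusion, which is already in the base; the rest is
classical. This reduces consistency of all derivable formulas to consistency of the base. -/
theorem Der.finEntails_base {R : Set (Rule F)} {φ : F} (h : AS.Der R φ) :
    𝓛.FinEntails (AS.base R) φ := by
  induction h with
  | ax h => exact .of_mem (Or.inl h)
  | entails Γ hfin _ h ih => exact .trans hfin ih h
  | rule r hr h _ => exact .of_mem (Or.inr ⟨r, hr, h, rfl⟩)

theorem RuleUndercut.mono {R R' : Set (Rule F)} (hR : R ⊆ R') {r : Rule F}
    (h : AS.RuleUndercut R r) : AS.RuleUndercut R' r := by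
  obtain ⟨ν, hν, φ, hφ, hop⟩ := h
  exact ⟨ν, hν, φ, hφ.mono hR, hop⟩

theorem Grounded.union {R Q : Set (Rule F)} (hR : AS.Grounded R) (hQ : AS.Grounded Q) :
    AS.Grounded (R ∪ Q) := by
  rintro r (hr | hr) φ hφ
  · exact (hR r hr φ hφ).mono Set.subset_union_left
  · exact (hQ r hr φ hφ).mono Set.subset_union_right

/-- Derivability is finitary in the set of rules. -/
theorem Der.exists_finite {R : Set (Rule F)} {φ : F} (h : AS.Der R φ) :
    ∃ R' ⊆ R, R'.Finite ∧ AS.Der R' φ := by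
  induction h with
  | ax h => exact ⟨∅, Set.empty_subset _, Set.finite_empty, .ax h⟩
  | entails Γ hfin _ h ih =>
    choose! R' hR' hR'fin hder using ih
    exact ⟨⋃ ψ ∈ Γ, R' ψ, Set.iUnion₂_subset hR', hfin.biUnion hR'fin,
      .entails Γ hfin (fun ψ hψ => (hder ψ hψ).mono (Set.subset_biUnion_of_mem (u := R') hψ)) h⟩
  | rule r hr _ ih =>
    choose! R' hR' hR'fin hder using ih
    refine ⟨insert r (⋃ ψ ∈ {ψ | ψ ∈ r.premises}, R' ψ),
      Set.insert_subset hr (Set.iUnion₂_subset hR'),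
      ((List.finite_toSet r.premises).biUnion hR'fin).insert _,
      .rule r (Set.mem_insert _ _) fun ψ hψ => (hder ψ hψ).mono ?_⟩
    exact (Set.subset_biUnion_of_mem (u := R') (s := {ψ | ψ ∈ r.premises}) hψ).trans
      (Set.subset_insert _ _)

theorem exists_finite_der {R : Set (Rule F)} {Γ : Set F} (hΓ : Γ.Finite)
    (h : ∀ φ ∈ Γ, AS.Der R φ) : ∃ R' ⊆ R, R'.Finite ∧ ∀ φ ∈ Γ, AS.Der R' φ := by
  choose! R' hR' hfin hder using fun φ hφ => (h φ hφ).exists_finite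
  exact ⟨⋃ ψ ∈ Γ, R' ψ, Set.iUnion₂_subset hR', hΓ.biUnion hfin,
    fun ψ hψ => (hder ψ hψ).mono (Set.subset_biUnion_of_mem (u := R') hψ)⟩

theorem finSat_der_empty : 𝓛.FinSat {φ | AS.Der ∅ φ} := by
  refine FinSat.of_finEntails AS.AX_sat.finSat fun φ hφ => hφ.finEntails_base.mono ?_
  rintro ψ (h | ⟨r, hr, -⟩)
  · exact h
  · exact hr.elim

/-! ### Good sets of rules and their maximal extensions -/

/-- The set of rules `R` is admissible with respect to the set `U` of all rules under
consideration. -/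
structure Good (AS : ArgSystem 𝓛) (U R : Set (Rule F)) : Prop where
  subset : R ⊆ U
  grounded : AS.Grounded R
  finSat : 𝓛.FinSat {φ | AS.Der R φ}
  not_undercut : ∀ r ∈ R, ¬ AS.RuleUndercut R r
  defended : ∀ Q ⊆ U, AS.Grounded Q → (∃ r ∈ R, AS.RuleUndercut Q r) →
    (∃ q ∈ Q, AS.RuleUndercut R q) ∨ ¬ 𝓛.FinSat {φ | AS.Der (R ∪ Q) φ}

theorem good_empty (U : Set (Rule F)) : AS.Good U ∅ where
  subset := Set.empty_subset _
  grounded := fun _ h => h.elim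
  finSat := finSat_der_empty
  not_undercut := fun _ h => h.elim
  defended := fun _ _ _ ⟨_, h, _⟩ => h.elim

/-- A derivation uses finitely many rules, so it already takes place in one member of the chain.
Defence against `Q` is inherited from the member containing the undercut rule, as undercutting and
inconsistency grow with the set. -/
theorem Good.sUnion {U : Set (Rule F)} {c : Set (Set (Rule F))} (hc : ∀ R ∈ c, AS.Good U R)
    (hchain : IsChain (· ⊆ ·) c) (hne : c.Nonempty) : AS.Good U (⋃₀ c) := by
  have key : ∀ Γ : Set F, Γ.Finite → (∀ φ ∈ Γ, AS.Der (⋃₀ c) φ) → ∃ R ∈ c, ∀ φ ∈ Γ, AS.Der R φ := by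
    intro Γ hfin hΓ
    obtain ⟨R', hR', hR'fin, hder⟩ := exists_finite_der hfin hΓ
    obtain ⟨R, hR, hsub⟩ :=
      DirectedOn.exists_mem_subset_of_finset_subset_biUnion (f := id) hne
        hchain.directedOn (s := hR'fin.toFinset) (by simpa [Set.sUnion_eq_biUnion] using hR')
    exact ⟨R, hR, fun φ hφ => (hder φ hφ).mono (by simpa using hsub)⟩
  have huc : ∀ r, AS.RuleUndercut (⋃₀ c) r → ∃ R ∈ c, AS.RuleUndercut R r := by
    rintro r ⟨ν, hν, φ, hφ, hop⟩
    obtain ⟨R, hR, h⟩ := key {φ} (Set.finite_singleton _) (by simpa using hφ)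
    exact ⟨R, hR, ν, hν, φ, h φ rfl, hop⟩
  refine ⟨Set.sUnion_subset fun R hR => (hc R hR).subset, ?_, ?_, ?_, ?_⟩
  · rintro r ⟨R, hR, hr⟩ φ hφ
    exact ((hc R hR).grounded r hr φ hφ).mono (Set.subset_sUnion_of_mem hR)
  · intro Γ hΓ hfin
    obtain ⟨R, hR, h⟩ := key Γ hfin hΓ
    exact (hc R hR).finSat Γ h hfin
  · rintro r ⟨R, hR, hr⟩ h
    obtain ⟨R', hR', h'⟩ := huc r h
    rcases hchain.total hR hR' with hle | hle
    · exact (hc R' hR').not_undercut r (hle hr) h'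
    · exact (hc R hR).not_undercut r hr (h'.mono hle)
  · rintro Q hQ hQg ⟨r, ⟨R, hR, hr⟩, h⟩
    refine ((hc R hR).defended Q hQ hQg ⟨r, hr, h⟩).imp ?_ ?_
    · rintro ⟨q, hq, h'⟩
      exact ⟨q, hq, h'.mono (Set.subset_sUnion_of_mem hR)⟩
    · exact mt fun h' => h'.mono fun φ hφ =>
        Der.mono (Set.union_subset_union_left _ (Set.subset_sUnion_of_mem hR)) hφ

theorem Good.exists_maximal {U R : Set (Rule F)} (h : AS.Good U R) :
    ∃ R', R ⊆ R' ∧ Maximal (AS.Good U) R' :=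
  zorn_subset_nonempty {R | AS.Good U R}
    (fun c hc hchain hne => ⟨⋃₀ c, Good.sUnion hc hchain hne, fun _ => Set.subset_sUnion_of_mem⟩)
    R h

end ArgSystem

/-! ### Arguments and derivability -/

namespace Arg

variable {F : Type u}

theorem self_mem_subs (a : Arg F) : a ∈ a.subs := by
  cases a <;> exact Set.mem_insert _ _

theorem subs_sub_subset_strict (n : ℕ) (s : Fin n → Arg F) (φ : F) (i : Fin n) :
    (s i).subs ⊆ (strict n s φ).subs :=
  (Set.subset_iUnion (fun i => (s i).subs) i).trans (Set.subset_insert _ _)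

theorem subs_sub_subset_defeasible (n : ℕ) (s : Fin n → Arg F) (φ : F) (i : Fin n) :
    (s i).subs ⊆ (defeasible n s φ).subs :=
  (Set.subset_iUnion (fun i => (s i).subs) i).trans (Set.subset_insert _ _)

theorem mem_defRules_iff {a : Arg F} {r : Rule F} :
    r ∈ a.defRules ↔ ∃ (n : ℕ) (s : Fin n → Arg F) (φ : F), defeasible n s φ ∈ a.subs ∧
      r = ⟨List.ofFn fun i => (s i).concl, φ⟩ := by
  induction a with
  | strict n s φ ih =>
    simp only [defRules, subs, Set.mem_iUnion, ih, Set.mem_insert_iff, reduceCtorEq, false_or]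
    aesop
  | defeasible n s φ ih =>
    simp only [defRules, subs, Set.mem_iUnion, ih, Set.mem_insert_iff]
    constructor
    · rintro (rfl | ⟨i, m, t, ψ, h, rfl⟩)
      · exact ⟨n, s, φ, Or.inl rfl, rfl⟩
      · exact ⟨m, t, ψ, Or.inr ⟨i, h⟩, rfl⟩
    · rintro ⟨m, t, ψ, h | ⟨i, h⟩, rfl⟩
      · cases h
        exact Or.inl rfl
      · exact Or.inr ⟨i, m, t, ψ, h, rfl⟩

theorem concl_mem_of_mem_defRules {a : Arg F} {r : Rule F} (h : r ∈ a.defRules) :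
    r.concl ∈ concl '' a.subs := by
  obtain ⟨n, s, φ, hs, rfl⟩ := mem_defRules_iff.1 h
  exact ⟨_, hs, rfl⟩

theorem subs_trans {a b : Arg F} (h : b ∈ a.subs) : b.subs ⊆ a.subs := by
  induction a with
  | strict n s φ ih =>
    rcases h with rfl | h
    · rfl
    · obtain ⟨i, hi⟩ := Set.mem_iUnion.1 h
      exact (ih i hi).trans (subs_sub_subset_strict n s φ i)
  | defeasible n s φ ih =>
    rcases h with rfl | h
    · rfl
    · obtain ⟨i, hi⟩ := Set.mem_iUnion.1 h
      exact (ih i hi).trans (subs_sub_subset_defeasible n s φ i)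

theorem defRules_subset_of_mem_subs {a b : Arg F} (h : b ∈ a.subs) :
    b.defRules ⊆ a.defRules := by
  intro r hr
  obtain ⟨n, s, φ, hs, rfl⟩ := mem_defRules_iff.1 hr
  exact mem_defRules_iff.2 ⟨n, s, φ, subs_trans h hs, rfl⟩

end Arg

namespace ArgSystem

open LogicalLanguage

variable {F : Type u} {I : Type v} {𝓛 : LogicalLanguage F I} {AS : ArgSystem 𝓛}

theorem IsArg.of_mem_subs {a b : Arg F} (ha : AS.IsArg a) (h : b ∈ a.subs) : AS.IsArg b := by
  induction a with
  | strict n s φ ih =>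
    rcases h with rfl | h
    · exact ha
    · obtain ⟨i, hi⟩ := Set.mem_iUnion.1 h
      exact ih i (ha.1 i) hi
  | defeasible n s φ ih =>
    rcases h with rfl | h
    · exact ha
    · obtain ⟨i, hi⟩ := Set.mem_iUnion.1 h
      exact ih i (ha.1 i) hi

theorem IsArg.der_concl {a : Arg F} (ha : AS.IsArg a) {R : Set (Rule F)} (hR : a.defRules ⊆ R) :
    AS.Der R a.concl := by
  induction a with
  | strict n s φ ih =>
    have hs : ∀ ψ ∈ List.ofFn fun i => (s i).concl, AS.Der R ψ := by
      intro ψ hψ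
      obtain ⟨i, rfl⟩ := (List.mem_ofFn' _ _).1 hψ
      exact ih i (ha.1 i) ((Set.subset_iUnion _ i).trans hR)
    rcases ha.2 with ⟨-, h⟩ | h
    · exact .ax h
    · exact .entails _ (List.finite_toSet _) hs h
  | defeasible n s φ ih =>
    refine Der.rule (AS := AS) ⟨List.ofFn fun i => (s i).concl, φ⟩ (hR (Set.mem_insert _ _)) ?_
    intro ψ hψ
    obtain ⟨i, rfl⟩ := (List.mem_ofFn' _ _).1 hψ
    exact ih i (ha.1 i) ((Set.subset_iUnion _ i).trans ((Set.subset_insert _ _).trans hR))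

theorem IsArg.der_of_mem_subs {a : Arg F} (ha : AS.IsArg a) {R : Set (Rule F)}
    (hR : a.defRules ⊆ R) {φ : F} (hφ : φ ∈ Arg.concl '' a.subs) : AS.Der R φ := by
  obtain ⟨b, hb, rfl⟩ := hφ
  exact (ha.of_mem_subs hb).der_concl ((Arg.defRules_subset_of_mem_subs hb).trans hR)

theorem IsArg.grounded {a : Arg F} (ha : AS.IsArg a) : AS.Grounded a.defRules := by
  intro r hr φ hφ
  obtain ⟨n, s, ψ, hs, rfl⟩ := Arg.mem_defRules_iff.1 hr
  obtain ⟨i, rfl⟩ := (List.mem_ofFn' _ _).1 hφ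
  exact ha.der_of_mem_subs subset_rfl
    ⟨s i, Arg.subs_trans hs (Arg.subs_sub_subset_defeasible n s ψ i (Arg.self_mem_subs _)), rfl⟩

theorem undercuts_iff {a b : AS.Argument} :
    AS.Undercuts a b ↔
      ∃ r ∈ b.1.defRules, ∃ ν, AS.name r = some ν ∧ 𝓛.Opposite a.1.concl ν := by
  constructor
  · rintro ⟨n, s, φ, ν, hs, hν, hop⟩
    exact ⟨_, Arg.mem_defRules_iff.2 ⟨n, s, φ, hs, rfl⟩, ν, hν, hop⟩
  · rintro ⟨r, hr, ν, hν, hop⟩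
    obtain ⟨n, s, φ, hs, rfl⟩ := Arg.mem_defRules_iff.1 hr
    exact ⟨n, s, φ, ν, hs, hν, hop⟩

theorem Undercuts.ruleUndercut {a b : AS.Argument} (h : AS.Undercuts a b) {R : Set (Rule F)}
    (hR : a.1.defRules ⊆ R) : ∃ r ∈ b.1.defRules, AS.RuleUndercut R r := by
  obtain ⟨r, hr, ν, hν, hop⟩ := undercuts_iff.1 h
  exact ⟨r, hr, ν, hν, _, a.2.der_concl hR, hop⟩

theorem GenRebuts.not_finSat {a b : AS.Argument} (h : AS.GenRebuts a b) {Δ : Set F}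
    (hb : Arg.concl '' b.1.subs ⊆ Δ) (ha : a.1.concl ∈ Δ) : ¬ 𝓛.FinSat Δ := by
  obtain ⟨-, Γ, hΓ, χ, hχ, heq⟩ := h
  exact hχ.not_finSat (hΓ.trans hb) (heq ▸ ha)

/-- A weakest rule of `a` is also a rule of `b`. Thus an attacker whose rules all occur in its
defeasible target is never strictly weaker, which is how preferences are neutralized. -/
theorem ewl_of_subset {a b : AS.Argument} (h : a.1.defRules ⊆ b.1.defRules)
    (hb : b.1.defRules.Nonempty) : AS.ewl b a := by
  rcases a.1.defRules.eq_empty_or_nonempty with ha | ha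
  · obtain ⟨r, hr⟩ := hb
    exact Or.inr ⟨r, hr, by simp [ha]⟩
  · obtain ⟨r, hr, hmin⟩ := AS.exists_weakest a ha
    exact Or.inr ⟨r, h hr, hmin⟩

theorem defeats_of_genRebuts {a b : AS.Argument} (h : AS.GenRebuts a b)
    (hsub : a.1.defRules ⊆ b.1.defRules) : AS.Defeats a b :=
  Or.inr ⟨h, fun h' => h'.2 (ewl_of_subset hsub h.1)⟩

/-! ### Supports, and arguments built from derivations -/

theorem supports_finite {S : Set AS.Argument} {c : AS.Argument} (h : AS.toJSBAF.supports S c) :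
    S.Finite := by
  obtain ⟨n, s, φ, -, rfl⟩ := h
  refine Set.Finite.of_finite_image (f := Subtype.val) ((Set.finite_range s).subset ?_)
    Subtype.val_injective.injOn
  rintro _ ⟨x, ⟨i, hi⟩, rfl⟩
  exact ⟨i, hi.symm⟩

theorem supports_defRules {S : Set AS.Argument} {c : AS.Argument}
    (h : AS.toJSBAF.supports S c) : c.1.defRules = ⋃ s ∈ S, s.1.defRules := by
  obtain ⟨n, s, φ, hc, rfl⟩ := h
  have harg : ∀ i, AS.IsArg (s i) := by
    have := c.2
    rw [hc] at this
    exact this.1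
  rw [hc]
  ext r
  simp only [Arg.defRules, Set.mem_iUnion, Set.mem_ofPred_eq, exists_prop]
  constructor
  · rintro ⟨i, hi⟩
    exact ⟨⟨s i, harg i⟩, ⟨i, rfl⟩, hi⟩
  · rintro ⟨x, ⟨i, hi⟩, hx⟩
    exact ⟨i, hi ▸ hx⟩

theorem supports_subs {S : Set AS.Argument} {c : AS.Argument} (h : AS.toJSBAF.supports S c)
    {s : AS.Argument} (hs : s ∈ S) : s.1.subs ⊆ c.1.subs := by
  obtain ⟨n, t, φ, hc, rfl⟩ := h
  obtain ⟨i, hi⟩ := hs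
  rw [hc, hi]
  exact Arg.subs_sub_subset_strict n t φ i

theorem supports_defRules_subset {S : Set AS.Argument} {c : AS.Argument}
    (h : AS.toJSBAF.supports S c) {s : AS.Argument} (hs : s ∈ S) :
    s.1.defRules ⊆ c.1.defRules := by
  rw [supports_defRules h]
  exact Set.subset_biUnion_of_mem (u := fun s : AS.Argument => s.1.defRules) hs

/-- Finitely many arguments can be combined by every classically valid inference. -/
theorem exists_supports {S : Set AS.Argument} (hS : S.Finite) {φ : F}
    (h : 𝓛.Entails ((fun a : AS.Argument => a.1.concl) '' S) φ) :
    ∃ c, AS.toJSBAF.supports S c ∧ c.1.concl = φ := by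
  have hmem : ∀ a, a ∈ hS.toFinset.toList ↔ a ∈ S := fun a => by simp
  generalize hS.toFinset.toList = l at hmem
  refine ⟨⟨.strict l.length (fun i => (l.get i).1) φ, fun i => (l.get i).2, Or.inr ?_⟩,
    ⟨_, _, _, rfl, ?_⟩, rfl⟩
  · refine Entails.mono h ?_
    rintro _ ⟨a, ha, rfl⟩
    obtain ⟨i, rfl⟩ := List.get_of_mem ((hmem a).2 ha)
    exact (List.mem_ofFn' _ _).2 ⟨i, rfl⟩
  · ext a
    rw [← hmem]
    constructor
    · intro ha
      obtain ⟨i, rfl⟩ := List.get_of_mem ha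
      exact ⟨i, rfl⟩
    · rintro ⟨i, hi⟩
      rw [Subtype.ext hi]
      exact List.get_mem l i

theorem exists_supports_of_mem_AX {φ : F} (h : φ ∈ AS.AX) :
    ∃ c, AS.toJSBAF.supports ∅ c ∧ c.1.concl = φ :=
  ⟨⟨.strict 0 Fin.elim0 φ, fun i => i.elim0, Or.inl ⟨by simp, h⟩⟩,
    ⟨_, _, _, rfl, by ext; simp⟩, rfl⟩

theorem defRules_eq_empty_of_isStrict {a : AS.Argument} (h : AS.toJSBAF.IsStrict a) :
    a.1.defRules = ∅ := by
  induction h with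
  | intro S a h _ ih =>
    rw [supports_defRules h]
    simpa using ih

theorem exists_argument_of_rule {R : Set (Rule F)} (hR : R ⊆ AS.Rd) {r : Rule F} (hr : r ∈ R)
    (h : ∀ φ ∈ r.premises, ∃ a : AS.Argument, a.1.concl = φ ∧ a.1.defRules ⊆ R) :
    ∃ a : AS.Argument, a.1.concl = r.concl ∧ r ∈ a.1.defRules ∧ a.1.defRules ⊆ R := by
  have h' : ∀ i : Fin r.premises.length,
      ∃ a : AS.Argument, a.1.concl = r.premises.get i ∧ a.1.defRules ⊆ R :=
    fun i => h _ (List.get_mem _ i)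
  choose f hf hf' using h'
  have hrule : (⟨List.ofFn fun i => (f i).1.concl, r.concl⟩ : Rule F) = r := by
    cases r
    simp_all
  refine ⟨⟨.defeasible _ (fun i => (f i).1) r.concl, fun i => (f i).2, ?_⟩, rfl, ?_, ?_⟩
  · rw [hrule]
    exact hR hr
  · rw [Arg.defRules, hrule]
    exact Set.mem_insert _ _
  · rw [Arg.defRules, hrule]
    exact Set.insert_subset hr (Set.iUnion_subset hf')

theorem exists_argument {R : Set (Rule F)} (hR : R ⊆ AS.Rd) {φ : F} (h : AS.Der R φ) :
    ∃ a : AS.Argument, a.1.concl = φ ∧ a.1.defRules ⊆ R := by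
  induction h with
  | ax h =>
    obtain ⟨c, hc, rfl⟩ := exists_supports_of_mem_AX h
    exact ⟨c, rfl, by simp [supports_defRules hc]⟩
  | @entails φ Γ hfin _ h ih =>
    choose f hf hf' using ih
    -- One argument is chosen per premise; finiteness of `Γ` makes these a finite support.
    have := hfin.to_subtype
    obtain ⟨c, hc, rfl⟩ := exists_supports (AS := AS)
      (Set.finite_range fun ψ : Γ => f ψ.1 ψ.2) (φ := φ)
      (h.mono fun ψ hψ => ⟨f ψ hψ, ⟨⟨ψ, hψ⟩, rfl⟩, hf ψ hψ⟩)
    refine ⟨c, rfl, ?_⟩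
    rw [supports_defRules hc]
    refine Set.iUnion₂_subset ?_
    rintro _ ⟨ψ, rfl⟩
    exact hf' ψ.1 ψ.2
  | rule r hr _ ih =>
    obtain ⟨a, ha, -, hsub⟩ := exists_argument_of_rule hR hr ih
    exact ⟨a, ha, hsub⟩

theorem exists_argument_of_mem {R : Set (Rule F)} (hR : R ⊆ AS.Rd) (hg : AS.Grounded R)
    {r : Rule F} (hr : r ∈ R) : ∃ a : AS.Argument, r ∈ a.1.defRules ∧ a.1.defRules ⊆ R := by
  obtain ⟨a, -, ha⟩ := exists_argument_of_rule hR hr fun φ hφ => exists_argument hR (hg r hr φ hφ)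
  exact ⟨a, ha⟩

/-! ### Passage between sets of arguments and sets of rules -/

/-- The set of defeasible rules used in a set of arguments. -/
def rulesOf (E : Set AS.Argument) : Set (Rule F) := ⋃ a ∈ E, a.1.defRules

theorem defRules_subset_rulesOf {E : Set AS.Argument} {a : AS.Argument} (ha : a ∈ E) :
    a.1.defRules ⊆ rulesOf E :=
  Set.subset_biUnion_of_mem (u := fun a : AS.Argument => a.1.defRules) ha

theorem rulesOf_mono {E E' : Set AS.Argument} (h : E ⊆ E') : rulesOf E ⊆ rulesOf E' :=
  Set.biUnion_subset_biUnion_left h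

theorem rulesOf_subset (E : Set AS.Argument) : rulesOf E ⊆ AS.Rd :=
  Set.iUnion₂_subset fun a _ => AS.defRules_subset a.1 a.2

/-- Groundedness makes every rule of `R` the top rule of an argument built from `R` alone, so no
rule is lost in passing to arguments and back. -/
theorem rulesOf_setOf_subset {R : Set (Rule F)} (hR : R ⊆ AS.Rd) (hg : AS.Grounded R) :
    rulesOf {a : AS.Argument | a.1.defRules ⊆ R} = R := by
  refine Set.Subset.antisymm (Set.iUnion₂_subset fun a ha => ha) fun r hr => ?_
  obtain ⟨a, ha, hsub⟩ := exists_argument_of_mem hR hg hr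
  exact defRules_subset_rulesOf (E := {a : AS.Argument | a.1.defRules ⊆ R}) hsub ha

theorem grounded_rulesOf (E : Set AS.Argument) : AS.Grounded (rulesOf E) := by
  intro r hr φ hφ
  obtain ⟨a, ha, hr⟩ := Set.mem_iUnion₂.1 hr
  exact (a.2.grounded r hr φ hφ).mono (defRules_subset_rulesOf ha)

theorem image_concl_setOf_subset {R : Set (Rule F)} (hR : R ⊆ AS.Rd) :
    (fun a : AS.Argument => a.1.concl) '' {a | a.1.defRules ⊆ R} = {φ | AS.Der R φ} := by
  ext φ
  constructor
  · rintro ⟨a, ha, rfl⟩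
    exact a.2.der_concl ha
  · intro hφ
    obtain ⟨a, rfl, ha⟩ := exists_argument hR hφ
    exact ⟨a, ha, rfl⟩

end ArgSystem

/-! ### Preferred labelings and maximal good sets of rules -/

theorem JSBAF.exists_weakest {A : Type u} (J : JSBAF A) {S : Set A} (hS : S.Finite)
    (hne : S.Nonempty) : ∃ a ∈ S, ∀ b ∈ S, J.pref a b := by
  have hrefl : ∀ a, J.pref a a := fun a => (J.pref_total a a).elim id id
  induction S, hS using Set.Finite.induction_on with
  | empty => exact absurd hne Set.not_nonempty_empty
  | @insert x T _ _ ih =>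
    rcases T.eq_empty_or_nonempty with rfl | hT
    · exact ⟨x, Set.mem_insert _ _, by simpa using hrefl x⟩
    · obtain ⟨a, ha, hmin⟩ := ih hT
      rcases J.pref_total a x with h | h
      · exact ⟨a, Set.mem_insert_of_mem _ ha, Set.forall_mem_insert.2 ⟨h, hmin⟩⟩
      · exact ⟨x, Set.mem_insert _ _, Set.forall_mem_insert.2
          ⟨hrefl x, fun b hb => J.pref_trans _ _ _ h (hmin b hb)⟩⟩

/-- The arguments accepted by an admissible labeling are closed under supports. -/
theorem JSBAF.Admissible.eq_in_of_supports {A : Type u} {J : JSBAF A} {L : A → Label}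
    (hL : J.Admissible L) {S : Set A} (hS : S.Finite) {c : A} (h : J.supports S c)
    (hin : S ⊆ inSet L) : L c = Label.IN := by
  rcases S.eq_empty_or_nonempty with rfl | hne
  · exact hL.2.2 c (.intro ∅ c h (by simp))
  · obtain ⟨a, ha, hmin⟩ := J.exists_weakest hS hne
    have hin' : ∀ b ∈ S, L b = Label.IN := hin
    -- The support clause constrains only a weakest member `a`; its alternatives to IN all need
    -- another member that is not IN.
    rcases (hL.1 a (hin ha)).2 S c h ha fun b hb => hmin b hb.1 with
      h | ⟨-, b, hb, h⟩ | ⟨-, ⟨b, hb, h⟩ | ⟨b, hb, -, -, -, h, -⟩⟩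
    · exact h
    all_goals simp [hin' b hb.1] at h

namespace ArgSystem

open LogicalLanguage

variable {F : Type u} {I : Type v} {𝓛 : LogicalLanguage F I} {AS : ArgSystem 𝓛}

/-- An unsatisfiable finite set is split into a part `Θ` in `B` and the remaining conclusions of
sub-arguments; `Θ` entails the negated conjunction of the latter. This turns inconsistency into the
conclusion of a gen-rebuttal. -/
theorem exists_isBigConj_of_not_finSat {B : Set F} {c : Arg F}
    (h : ¬ 𝓛.FinSat (B ∪ Arg.concl '' c.subs)) :
    ∃ Θ ⊆ B, Θ.Finite ∧ ∃ Γ ⊆ Arg.concl '' c.subs, ∃ χ, 𝓛.IsBigConj Γ χ ∧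
      𝓛.Entails Θ (𝓛.neg χ) := by
  simp only [FinSat, not_forall] at h
  obtain ⟨Δ, hΔ, hfin, hunsat⟩ := h
  -- Inserting `c.concl` only ensures that the conjunction is non-empty.
  obtain ⟨χ, hχ⟩ := exists_isBigConj (𝓛 := 𝓛)
    ((hfin.inter_of_left (Arg.concl '' c.subs)).insert c.concl) (Set.insert_nonempty _ _)
  refine ⟨Δ ∩ B, Set.inter_subset_right, hfin.inter_of_left B, _,
    Set.insert_subset ⟨c, c.self_mem_subs, rfl⟩ Set.inter_subset_right, χ, hχ, fun i hi => ?_⟩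
  refine (𝓛.models_neg i χ).2 fun hiχ => hunsat ⟨i, fun φ hφ => ?_⟩
  rcases hΔ hφ with hB | hc
  · exact hi φ ⟨hφ, hB⟩
  · exact (hχ.models_iff i).1 hiχ φ (Set.mem_insert_of_mem _ ⟨hφ, hc⟩)

/-- The base of the joint rule set consists of axioms, conclusions of `R`, and conclusions of
sub-arguments of `a`. Groundedness is what makes the second kind derivable without the rules of `a`.
-/
theorem not_finSat_union_subs {R : Set (Rule F)} (hR : AS.Grounded R) {a : Arg F}
    (h : ¬ 𝓛.FinSat {φ | AS.Der (R ∪ a.defRules) φ}) :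
    ¬ 𝓛.FinSat ({φ | AS.Der R φ} ∪ Arg.concl '' a.subs) := by
  refine mt (fun h' => FinSat.of_finEntails h' fun φ hφ => hφ.finEntails_base.mono ?_) h
  rintro ψ (hψ | ⟨r, hr | hr, -, rfl⟩)
  · exact Or.inl (.ax hψ)
  · exact Or.inl (.rule r hr (hR r hr))
  · exact Or.inr (Arg.concl_mem_of_mem_defRules hr)

theorem not_finSat_ax_union_subs {a : Arg F} (h : ¬ 𝓛.FinSat {φ | AS.Der a.defRules φ}) :
    ¬ 𝓛.FinSat (AS.AX ∪ Arg.concl '' a.subs) := by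
  refine mt (fun h' => FinSat.of_finEntails h' fun φ hφ => hφ.finEntails_base.mono ?_) h
  rintro ψ (hψ | ⟨r, hr, -, rfl⟩)
  · exact Or.inl hψ
  · exact Or.inr (Arg.concl_mem_of_mem_defRules hr)

/-! #### From admissible labelings to good sets of rules -/

theorem isStrict_of_defRules_eq_empty (a : Arg F) (ha : AS.IsArg a) (h : a.defRules = ∅) :
    AS.toJSBAF.IsStrict ⟨a, ha⟩ := by
  induction a with
  | strict n s φ ih =>
    refine .intro {x | ∃ i, x.1 = s i} _ ⟨n, s, φ, rfl, rfl⟩ ?_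
    rintro ⟨_, hx⟩ ⟨i, rfl⟩
    exact ih i hx (Set.iUnion_eq_empty.1 h i)
  | defeasible n s φ ih => exact absurd h (Set.insert_nonempty _ _).ne_empty

theorem not_defeats_of_in {L : AS.Argument → Label} (hL : AS.toJSBAF.Admissible L)
    {a b : AS.Argument} (ha : L a = Label.IN) (hb : L b = Label.IN) : ¬ AS.Defeats a b := by
  intro h
  have := (hL.1 b hb).1 a h
  simp [ha] at this

/-- Finitely many accepted arguments can be combined to a single accepted argument. -/
theorem exists_in_defRules {L : AS.Argument → Label} (hL : AS.toJSBAF.Admissible L) (φ : F)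
    {T : Set AS.Argument} (hT : T.Finite) (hin : T ⊆ inSet L) :
    ∃ c, L c = Label.IN ∧ ∀ s ∈ T, s.1.defRules ⊆ c.1.defRules := by
  -- Any tautology will do as conclusion; `φ` merely supplies a formula to build one.
  obtain ⟨c, hc, -⟩ := exists_supports hT (φ := 𝓛.neg (𝓛.conj φ (𝓛.neg φ)))
    fun i _ => by simp [𝓛.models_neg, 𝓛.models_conj]
  exact ⟨c, hL.eq_in_of_supports hT hc hin, fun s hs => supports_defRules_subset hc hs⟩

theorem exists_in_of_finite {L : AS.Argument → Label} (hL : AS.toJSBAF.Admissible L) (φ : F)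
    {R : Set (Rule F)} (hR : R.Finite) (hin : R ⊆ rulesOf (inSet L)) :
    ∃ c, L c = Label.IN ∧ R ⊆ c.1.defRules := by
  choose f hf hrf using fun r (hr : r ∈ R) => Set.mem_iUnion₂.1 (hin hr)
  have := hR.to_subtype
  obtain ⟨c, hc, hsub⟩ := exists_in_defRules hL φ
    (Set.finite_range fun r : R => f r.1 r.2) (by rintro _ ⟨r, rfl⟩; exact hf r.1 r.2)
  exact ⟨c, hc, fun r hr => hsub _ ⟨⟨r, hr⟩, rfl⟩ (hrf r hr)⟩

/-- The conclusions of the sub-arguments of an accepted argument are consistent, as otherwise it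
is gen-rebutted by a strict argument. -/
theorem finSat_der_defRules {L : AS.Argument → Label} (hL : AS.toJSBAF.Admissible L)
    {c : AS.Argument} (hc : L c = Label.IN) : 𝓛.FinSat {φ | AS.Der c.1.defRules φ} := by
  by_contra h
  have hne : c.1.defRules.Nonempty := by
    by_contra hemp
    rw [Set.not_nonempty_iff_eq_empty.1 hemp] at h
    exact h finSat_der_empty
  obtain ⟨Θ, hΘ, hfin, Γ, hΓ, χ, hχ, hent⟩ :=
    exists_isBigConj_of_not_finSat (not_finSat_ax_union_subs h)
  obtain ⟨e, he, hsub⟩ := exists_argument (AS := AS) (Set.empty_subset _)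
    (.entails Θ hfin (fun ψ hψ => .ax (hΘ hψ)) hent)
  have hemp := Set.subset_empty_iff.1 hsub
  exact not_defeats_of_in hL (hL.2.2 e (isStrict_of_defRules_eq_empty e.1 e.2 hemp)) hc
    (defeats_of_genRebuts ⟨hne, Γ, hΓ, χ, hχ, he⟩ (by simp [hemp]))

/-- Arguments that are legally `OUT` become attacked by an accepted argument when they are
combined with a suitable accepted argument. -/
theorem exists_defeats_of_legallyOut {L : AS.Argument → Label}
    (hL : AS.toJSBAF.Admissible L) {x : AS.Argument} (hx : AS.toJSBAF.LegallyOut L x) :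
    ∃ e f y : AS.Argument, L e = Label.IN ∧ L f = Label.IN ∧
      y.1.defRules ⊆ x.1.defRules ∪ f.1.defRules ∧ AS.Defeats e y := by
  rcases hx with ⟨e, he, hein⟩ | ⟨n, S, b, ⟨hS, hSb⟩, hxS, hxin, ⟨e, he, hein⟩, -, hbin, -⟩
  · exact ⟨e, e, x, hein, hein, Set.subset_union_left, he⟩
  -- Along the chain, everything joined to `x` is IN; at each link the new arguments are merged with
  -- the previous accepted argument.
  · have key : ∀ i ≤ n, ∃ f : AS.Argument, L f = Label.IN ∧
        (b i).1.defRules ⊆ x.1.defRules ∪ f.1.defRules := by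
      intro i
      induction i with
      | zero =>
        intro _
        obtain ⟨f, hf, hsub⟩ := exists_in_defRules hL x.1.concl
          ((supports_finite (hS 0 (Nat.zero_le n))).sdiff (t := {x})) hxin
        refine ⟨f, hf, ?_⟩
        rw [supports_defRules (hS 0 (Nat.zero_le n))]
        refine Set.iUnion₂_subset fun s hs => ?_
        by_cases hsx : s = x
        · exact hsx ▸ Set.subset_union_left
        · exact (hsub s ⟨hs, hsx⟩).trans Set.subset_union_right
      | succ i ih =>
        intro hi
        obtain ⟨g, hg, hgsub⟩ := ih (by omega)
        obtain ⟨f, hf, hsub⟩ := exists_in_defRules hL x.1.concl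
          (((supports_finite (hS (i + 1) hi)).sdiff (t := {b i})).insert g)
          (Set.insert_subset hg (hbin i hi))
        refine ⟨f, hf, ?_⟩
        rw [supports_defRules (hS (i + 1) hi)]
        refine Set.iUnion₂_subset fun s hs => ?_
        by_cases hsb : s = b i
        · rw [hsb]
          exact hgsub.trans (Set.union_subset_union_right _ (hsub g (Set.mem_insert _ _)))
        · exact (hsub s (Set.mem_insert_of_mem _ ⟨hs, hsb⟩)).trans Set.subset_union_right
    obtain ⟨f, hf, hsub⟩ := key n le_rfl
    exact ⟨e, f, b n, hein, hf, hsub, he⟩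

/-- Merge `c` with the accepted arguments that witness the attack. The result is accepted and
contains all rules involved, so it would be undercut by an accepted argument or be inconsistent. -/
theorem not_subset_of_legallyOut {L : AS.Argument → Label} (hL : AS.toJSBAF.Admissible L)
    {x c : AS.Argument} (hx : AS.toJSBAF.LegallyOut L x) (hc : L c = Label.IN) :
    ¬ x.1.defRules ⊆ c.1.defRules := by
  intro hxc
  obtain ⟨e, f, y, he, hf, hsub, h⟩ := exists_defeats_of_legallyOut hL hx
  obtain ⟨g, hg, hgsub⟩ := exists_in_defRules hL x.1.concl (T := {e, f, c}) (by simp)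
    (by rintro _ (rfl | rfl | rfl) <;> assumption)
  have heg := hgsub e (by simp)
  have hyg : y.1.defRules ⊆ g.1.defRules :=
    hsub.trans (Set.union_subset (hxc.trans (hgsub c (by simp))) (hgsub f (by simp)))
  rcases h with h | ⟨h, -⟩
  · obtain ⟨r, hr, hν⟩ := undercuts_iff.1 h
    exact not_defeats_of_in hL he hg (Or.inl (undercuts_iff.2 ⟨r, hyg hr, hν⟩))
  · exact h.not_finSat (fun φ hφ => y.2.der_of_mem_subs hyg hφ) (e.2.der_concl heg)
      (finSat_der_defRules hL hg)

/-- Consistency and absence of undercuts involve finitely many accepted rules, which fit into one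
accepted argument. Defence comes from an undercutter of an accepted argument having to be legally
OUT. -/
theorem Good.of_admissible {L : AS.Argument → Label} (hL : AS.toJSBAF.Admissible L) :
    AS.Good AS.Rd (rulesOf (inSet L)) where
  subset := rulesOf_subset _
  grounded := grounded_rulesOf _
  finSat := by
    intro Γ hΓ hfin
    rcases Γ.eq_empty_or_nonempty with rfl | ⟨φ, -⟩
    · exact AS.AX_sat.imp fun _ _ => by simp
    obtain ⟨R, hR, hRfin, hder⟩ := exists_finite_der hfin hΓ
    obtain ⟨c, hc, hsub⟩ := exists_in_of_finite hL φ hRfin hR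
    exact finSat_der_defRules hL hc Γ (fun ψ hψ => (hder ψ hψ).mono hsub) hfin
  not_undercut := by
    rintro r hr ⟨ν, hν, φ, hφ, hop⟩
    obtain ⟨R, hR, hRfin, hder⟩ := hφ.exists_finite
    obtain ⟨c, hc, hsub⟩ := exists_in_of_finite hL φ (hRfin.insert r) (Set.insert_subset hr hR)
    obtain ⟨d, rfl, hd⟩ := exists_argument (hR.trans (rulesOf_subset _)) hder
    refine not_subset_of_legallyOut hL ((hL.2.1 d).1 ((hL.1 c hc).1 d (Or.inl ?_))) hc
      (hd.trans ((Set.subset_insert _ _).trans hsub))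
    exact undercuts_iff.2 ⟨r, hsub (Set.mem_insert _ _), ν, hν, hop⟩
  defended := by
    rintro Q hQ hQg ⟨r, hr, ν, hν, φ, hφ, hop⟩
    obtain ⟨a, ha, hra⟩ := Set.mem_iUnion₂.1 hr
    obtain ⟨d, rfl, hd⟩ := exists_argument hQ hφ
    obtain ⟨e, f, y, he, hf, hsub, h⟩ := exists_defeats_of_legallyOut hL
      ((hL.2.1 d).1 ((hL.1 a ha).1 d (Or.inl (undercuts_iff.2 ⟨r, hra, ν, hν, hop⟩))))
    have heR := defRules_subset_rulesOf (E := inSet L) he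
    rcases h with h | ⟨h, -⟩
    · left
      obtain ⟨q, hq, ν', hν', hop'⟩ := undercuts_iff.1 h
      -- The undercut rule comes from the attacker `d`, hence from `Q`, or from the accepted `f`,
      -- which no accepted argument attacks.
      rcases hsub hq with hq | hq
      · exact ⟨q, hd hq, ν', hν', _, e.2.der_concl heR, hop'⟩
      · exact (not_defeats_of_in hL he hf (Or.inl (undercuts_iff.2 ⟨q, hq, ν', hν', hop'⟩))).elim
    · right
      have hy : y.1.defRules ⊆ rulesOf (inSet L) ∪ Q :=
        hsub.trans (Set.union_subset (hd.trans Set.subset_union_right)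
          ((defRules_subset_rulesOf (E := inSet L) hf).trans Set.subset_union_left))
      exact h.not_finSat (fun φ hφ => y.2.der_of_mem_subs hy hφ)
        (e.2.der_concl (heR.trans Set.subset_union_left))

/-! #### From good sets of rules to admissible labelings -/

/-- `Q` is undercut by `R` or not consistent with `R`. -/
def Rejects (AS : ArgSystem 𝓛) (R Q : Set (Rule F)) : Prop :=
  (∃ q ∈ Q, AS.RuleUndercut R q) ∨ ¬ 𝓛.FinSat {φ | AS.Der (R ∪ Q) φ}

open Classical in
/-- The labeling that accepts the arguments that only use rules in `R`. -/
noncomputable def labeling (AS : ArgSystem 𝓛) (R : Set (Rule F)) (a : AS.Argument) : Label :=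
  if AS.Rejects R a.1.defRules then Label.OUT
  else if a.1.defRules ⊆ R then Label.IN else Label.UNDEC

theorem labeling_eq_out_iff {R : Set (Rule F)} {a : AS.Argument} :
    AS.labeling R a = Label.OUT ↔ AS.Rejects R a.1.defRules := by
  unfold labeling
  split_ifs <;> simp_all

/-- Rejection only depends on the rules outside of `R`. -/
theorem Good.rejects_of_subset {U R Q Q' : Set (Rule F)} (hR : AS.Good U R)
    (hQ : Q ⊆ R ∪ Q') (h : AS.Rejects R Q) : AS.Rejects R Q' := by
  rcases h with ⟨q, hq, h⟩ | h
  · exact Or.inl ⟨q, (hQ hq).resolve_left fun hq' => hR.not_undercut q hq' h, h⟩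
  · exact Or.inr (mt (fun h' => h'.mono fun φ hφ =>
      Der.mono (Set.union_subset Set.subset_union_left hQ) hφ) h)

theorem Good.not_rejects {U R Q : Set (Rule F)} (hR : AS.Good U R) (hQ : Q ⊆ R) :
    ¬ AS.Rejects R Q := by
  rintro (⟨q, hq, h⟩ | h)
  · exact hR.not_undercut q (hQ hq) h
  · rw [Set.union_eq_left.2 hQ] at h
    exact h hR.finSat

theorem Good.labeling_eq_in_iff {U R : Set (Rule F)} (hR : AS.Good U R) {a : AS.Argument} :
    AS.labeling R a = Label.IN ↔ a.1.defRules ⊆ R := by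
  have := hR.not_rejects (Q := a.1.defRules)
  unfold labeling
  split_ifs <;> simp_all

theorem Good.inSet_labeling {U R : Set (Rule F)} (hR : AS.Good U R) :
    inSet (AS.labeling R) = {a | a.1.defRules ⊆ R} :=
  Set.ext fun _ => hR.labeling_eq_in_iff

theorem Defeats.rejects {a b : AS.Argument} (h : AS.Defeats a b) {R : Set (Rule F)}
    (ha : a.1.defRules ⊆ R) : AS.Rejects R b.1.defRules := by
  rcases h with h | ⟨h, -⟩
  · exact Or.inl (h.ruleUndercut ha)
  · exact Or.inr (h.not_finSat
      (fun φ hφ => b.2.der_of_mem_subs Set.subset_union_right hφ)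
      (a.2.der_concl (ha.trans Set.subset_union_left)))

/-- Undercutters are rejected by `defended`, gen-rebutters by inconsistency. For supports, adding
arguments over `R` does not affect rejection, so a supported argument that is OUT has either an OUT
co-supporter or two UNDEC ones. -/
theorem Good.legallyIn {R : Set (Rule F)} (hR : AS.Good AS.Rd R) {a : AS.Argument}
    (ha : a.1.defRules ⊆ R) : AS.toJSBAF.LegallyIn (AS.labeling R) a := by
  refine ⟨fun b hb => labeling_eq_out_iff.2 ?_, fun S c hSc haS _ => ?_⟩
  · rcases hb with hb | ⟨hb, -⟩
    · obtain ⟨r, hr, hu⟩ := hb.ruleUndercut subset_rfl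
      exact hR.defended _ (AS.defRules_subset b.1 b.2) b.2.grounded ⟨r, ha hr, hu⟩
    · exact Or.inr (hb.not_finSat
        (fun φ hφ => a.2.der_of_mem_subs (ha.trans Set.subset_union_left) hφ)
        (b.2.der_concl Set.subset_union_right))
  · have hin : (∀ b ∈ S \ {a}, AS.labeling R b = Label.IN) → AS.labeling R c = Label.IN := by
      intro h
      rw [hR.labeling_eq_in_iff, supports_defRules hSc]
      refine Set.iUnion₂_subset fun s hs => ?_
      by_cases hsa : s = a
      · exact hsa ▸ ha
      · exact hR.labeling_eq_in_iff.1 (h s ⟨hs, hsa⟩)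
    cases hc : AS.labeling R c with
    | IN => exact Or.inl rfl
    | UNDEC =>
      refine Or.inr (Or.inl ⟨rfl, ?_⟩)
      by_contra! h
      have := hin fun b hb => by
        have := h b hb
        cases hb' : AS.labeling R b <;> simp_all
      simp [hc] at this
    | OUT =>
      refine Or.inr (Or.inr ⟨rfl, ?_⟩)
      by_contra! h
      obtain ⟨hout, hundec⟩ := h
      have : ∃ b ∈ S \ {a}, AS.labeling R b ≠ Label.IN := by
        by_contra! h
        have := hin h
        simp [hc] at this
      obtain ⟨b, hb, hbin⟩ := this
      have hbund : AS.labeling R b = Label.UNDEC := by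
        have := hout b hb
        cases hb' : AS.labeling R b <;> simp_all
      -- Here `b` is the only member that is not IN, so rejection of `c` passes to `b`.
      refine hout b hb (labeling_eq_out_iff.2
        (hR.rejects_of_subset ?_ (labeling_eq_out_iff.1 hc)))
      rw [supports_defRules hSc]
      refine Set.iUnion₂_subset fun s hs => ?_
      by_cases hsb : s = b
      · exact hsb ▸ Set.subset_union_right
      refine Set.Subset.trans ?_ Set.subset_union_left
      by_cases hsa : s = a
      · exact hsa ▸ ha
      · refine hR.labeling_eq_in_iff.1 ?_
        have h₁ := hout s ⟨hs, hsa⟩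
        have h₂ := hundec b hb s ⟨hs, hsa⟩ (Ne.symm hsb) hbund
        cases hs' : AS.labeling R s <;> simp_all

theorem Good.legallyOut {R : Set (Rule F)} (hR : AS.Good AS.Rd R) {a : AS.Argument}
    (ha : AS.Rejects R a.1.defRules) : AS.toJSBAF.LegallyOut (AS.labeling R) a := by
  rcases ha with ⟨q, hq, ν, hν, φ, hφ, hop⟩ | hunsat
  · obtain ⟨b, rfl, hb⟩ := exists_argument hR.subset hφ
    exact Or.inl ⟨b, Or.inl (undercuts_iff.2 ⟨q, hq, ν, hν, hop⟩), hR.labeling_eq_in_iff.2 hb⟩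
  · have ha : AS.Rejects R a.1.defRules := Or.inr hunsat
    have hne : a.1.defRules.Nonempty := by
      by_contra hemp
      rw [Set.not_nonempty_iff_eq_empty.1 hemp] at ha
      exact hR.not_rejects (Set.empty_subset _) ha
    obtain ⟨Θ, hΘ, hfin, Γ, hΓ, χ, hχ, hent⟩ :=
      exists_isBigConj_of_not_finSat (not_finSat_union_subs hR.grounded hunsat)
    obtain ⟨e, he, hsub⟩ := exists_argument hR.subset (.entails Θ hfin hΘ hent)
    -- The rebutter `e` may be strictly weaker than `a`, so `e` is absorbed into the target.
    -- Starting from `{a, e}` would require that `a` be no stronger than `e`; the detour through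
    -- `b`, supported by `{a}` alone, avoids this, since later links of a chain carry no preference
    -- condition.
    obtain ⟨b, hb, -⟩ := exists_supports (AS := AS) (Set.finite_singleton a) (φ := a.1.concl)
      (.of_mem ⟨a, rfl, rfl⟩)
    obtain ⟨c, hc, -⟩ := exists_supports (AS := AS) (S := {b, e}) (by simp) (φ := e.1.concl)
      (.of_mem ⟨e, by simp, rfl⟩)
    have hab : a.1.defRules ⊆ b.1.defRules := supports_defRules_subset hb rfl
    have hbc : b.1.defRules ⊆ c.1.defRules := supports_defRules_subset hc (by simp)
    have hec : e.1.defRules ⊆ c.1.defRules := supports_defRules_subset hc (by simp)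
    have hebut : AS.GenRebuts e c := by
      refine ⟨hne.mono (hab.trans hbc), Γ, hΓ.trans (Set.image_mono ?_), χ, hχ, he⟩
      exact (supports_subs hb rfl).trans (supports_subs hc (by simp))
    refine Or.inr ⟨1, fun i => if i = 0 then {a} else {b, e}, fun i => if i = 0 then b else c,
      ⟨?_, ?_⟩, by simp, by simp, ⟨e, ?_, hR.labeling_eq_in_iff.2 hsub⟩, ?_, ?_, by simp⟩
    · rintro i hi
      dsimp only
      split_ifs
      · exact hb
      · exact hc
    · rintro i hi
      obtain rfl : i = 0 := by omega
      simp
    · exact defeats_of_genRebuts hebut hec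
    · intro i _
      refine labeling_eq_out_iff.2 (hR.rejects_of_subset (Set.Subset.trans ?_
        Set.subset_union_right) ha)
      dsimp only
      split_ifs
      · exact hab
      · exact hab.trans hbc
    · intro i hi
      obtain rfl : i = 0 := by omega
      rintro d ⟨hd, hdb⟩
      obtain rfl : d = e := by simp_all
      exact hR.labeling_eq_in_iff.2 hsub

theorem Good.admissible_labeling {R : Set (Rule F)} (hR : AS.Good AS.Rd R) :
    AS.toJSBAF.Admissible (AS.labeling R) := by
  refine ⟨fun a ha => hR.legallyIn (hR.labeling_eq_in_iff.1 ha), fun a =>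
    ⟨fun h => hR.legallyOut (labeling_eq_out_iff.1 h), fun h => labeling_eq_out_iff.2 ?_⟩,
    fun a ha => hR.labeling_eq_in_iff.2 (by simp [defRules_eq_empty_of_isStrict ha])⟩
  rcases h with ⟨b, hb, hbin⟩ | ⟨n, S, b, ⟨hS, -⟩, -, hin, -, hout, -, -⟩
  · exact hb.rejects (hR.labeling_eq_in_iff.1 hbin)
  -- The first link suffices: `b 0` is OUT, and apart from `a` its supporters use only rules of `R`.
  · refine hR.rejects_of_subset ?_ (labeling_eq_out_iff.1 (hout 0 (Nat.zero_le n)))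
    rw [supports_defRules (hS 0 (Nat.zero_le n))]
    refine Set.iUnion₂_subset fun s hs => ?_
    by_cases hsa : s = a
    · exact hsa ▸ Set.subset_union_right
    · exact (hR.labeling_eq_in_iff.1 (hin s ⟨hs, hsa⟩)).trans Set.subset_union_left

/-- The preferred conclusions are the sets of formulas derivable from maximal good sets of
rules. -/
theorem conclusions_preferredSemantics (AS : ArgSystem 𝓛) :
    (preferredSemantics 𝓛).conclusions AS =
      {T | ∃ R, Maximal (AS.Good AS.Rd) R ∧ T = {φ | AS.Der R φ}} := by
  ext T
  constructor
  · rintro ⟨_, ⟨L, ⟨hL, hmax⟩, rfl⟩, rfl⟩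
    have hR := Good.of_admissible hL
    have hin : {a : AS.Argument | a.1.defRules ⊆ rulesOf (inSet L)} = inSet L := by
      rw [← hR.inSet_labeling]
      refine hmax _ hR.admissible_labeling ?_
      rw [hR.inSet_labeling]
      exact fun a ha => defRules_subset_rulesOf ha
    refine ⟨rulesOf (inSet L), ⟨hR, fun R' hR' hle => ?_⟩, ?_⟩
    · have hin' := hmax _ hR'.admissible_labeling (by
        rw [hR'.inSet_labeling]
        exact fun a ha => (defRules_subset_rulesOf ha).trans hle)
      rw [← hin', hR'.inSet_labeling, rulesOf_setOf_subset hR'.subset hR'.grounded]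
    · rw [← image_concl_setOf_subset hR.subset, hin]
  · rintro ⟨R, ⟨hR, hmax⟩, rfl⟩
    refine ⟨_, ⟨AS.labeling R, ⟨hR.admissible_labeling, fun L' hL' hle => ?_⟩, rfl⟩, ?_⟩
    · refine Set.Subset.antisymm (fun a ha => ?_) hle
      rw [hR.inSet_labeling] at hle ⊢
      -- A larger admissible labeling yields a larger good set, so maximality of `R` bounds its
      -- rules.
      refine (defRules_subset_rulesOf ha).trans (hmax (Good.of_admissible hL') ?_)
      have := rulesOf_mono hle
      rwa [rulesOf_setOf_subset hR.subset hR.grounded] at this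
    · rw [hR.inSet_labeling, image_concl_setOf_subset hR.subset]

end ArgSystem

namespace ArgSystem

open LogicalLanguage

variable {F : Type u} {I : Type v} {𝓛 : LogicalLanguage F I} {AS AS₁ AS₂ : ArgSystem 𝓛}

/-! ### Tautological rules -/

/-- The rules whose conclusion is tautological. -/
def tautRules (𝓛 : LogicalLanguage F I) : Set (Rule F) := {r | ∀ i, 𝓛.models i r.concl}

theorem Der.sdiff_tautRules {R : Set (Rule F)} {φ : F} (h : AS.Der R φ) :
    AS.Der (R \ tautRules 𝓛) φ := by
  induction h with
  | ax h => exact .ax h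
  | entails Γ hfin _ h ih => exact .entails Γ hfin ih h
  | rule r hr _ ih =>
    by_cases hr' : r ∈ tautRules 𝓛
    · exact .entails ∅ Set.finite_empty (by simp) fun i _ => hr' i
    · exact .rule r ⟨hr, hr'⟩ ih

theorem der_sdiff_tautRules (R : Set (Rule F)) :
    {φ | AS.Der (R \ tautRules 𝓛) φ} = {φ | AS.Der R φ} :=
  Set.ext fun _ => ⟨fun h => h.mono Set.sdiff_subset, Der.sdiff_tautRules⟩

theorem RuleUndercut.sdiff_tautRules {R : Set (Rule F)} {r : Rule F} (h : AS.RuleUndercut R r) :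
    AS.RuleUndercut (R \ tautRules 𝓛) r := by
  obtain ⟨ν, hν, φ, hφ, hop⟩ := h
  exact ⟨ν, hν, φ, hφ.sdiff_tautRules, hop⟩

theorem Grounded.sdiff_tautRules {R : Set (Rule F)} (h : AS.Grounded R) :
    AS.Grounded (R \ tautRules 𝓛) := fun r hr φ hφ => (h r hr.1 φ hφ).sdiff_tautRules

theorem Good.sdiff_tautRules {U R : Set (Rule F)} (h : AS.Good U R) :
    AS.Good (U \ tautRules 𝓛) (R \ tautRules 𝓛) where
  subset := Set.sdiff_subset_sdiff_left h.subset
  grounded := h.grounded.sdiff_tautRules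
  finSat := by simpa only [der_sdiff_tautRules] using h.finSat
  not_undercut r hr hu := h.not_undercut r hr.1 (hu.mono Set.sdiff_subset)
  defended := by
    rintro Q hQ hQg ⟨r, hr, hu⟩
    refine (h.defended Q (hQ.trans Set.sdiff_subset) hQg ⟨r, hr.1, hu⟩).imp ?_ ?_
    · rintro ⟨q, hq, hu'⟩
      exact ⟨q, hq, hu'.sdiff_tautRules⟩
    · refine mt fun h' => h'.mono ?_
      rw [← der_sdiff_tautRules (R ∪ Q), Set.union_sdiff_distrib]
      exact fun φ => Der.mono (Set.union_subset_union_right _ Set.sdiff_subset)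

theorem Good.of_sdiff_tautRules {U R : Set (Rule F)} (h : AS.Good (U \ tautRules 𝓛) R) :
    AS.Good U R where
  subset := h.subset.trans Set.sdiff_subset
  grounded := h.grounded
  finSat := h.finSat
  not_undercut := h.not_undercut
  defended := by
    rintro Q hQ hQg ⟨r, hr, hu⟩
    refine (h.defended (Q \ tautRules 𝓛) (Set.sdiff_subset_sdiff_left hQ) hQg.sdiff_tautRules
      ⟨r, hr, hu.sdiff_tautRules⟩).imp ?_ ?_
    · rintro ⟨q, hq, hu'⟩
      exact ⟨q, hq.1, hu'⟩
    · exact mt fun h' => h'.mono fun φ =>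
        Der.mono (Set.union_subset_union_right _ Set.sdiff_subset)

/-- The union derives nothing beyond `R'`, because the extra rules are tautological. This lets a
competitor of the reduced set be compared with the unreduced maximal `R`. -/
theorem Good.union_of_sdiff_tautRules_subset {U R R' : Set (Rule F)} (h : AS.Good U R)
    (h' : AS.Good U R') (hsub : R \ tautRules 𝓛 ⊆ R') : AS.Good U (R ∪ R') := by
  have hRR' : ∀ φ, AS.Der R φ → AS.Der R' φ := fun φ hφ => hφ.sdiff_tautRules.mono hsub
  have hdiff : (R ∪ R') \ tautRules 𝓛 ⊆ R' := by
    rw [Set.union_sdiff_distrib]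
    exact Set.union_subset hsub Set.sdiff_subset
  have hder : ∀ φ, AS.Der (R ∪ R') φ → AS.Der R' φ := fun φ hφ => hφ.sdiff_tautRules.mono hdiff
  refine ⟨Set.union_subset h.subset h'.subset, h.grounded.union h'.grounded,
    h'.finSat.mono hder, ?_, ?_⟩
  · rintro r hr hu
    have hu' := hu.sdiff_tautRules.mono hdiff
    rcases hr with hr | hr
    · rcases h.defended R' h'.subset h'.grounded ⟨r, hr, hu'⟩ with ⟨q, hq, hqu⟩ | hunsat
      · exact h'.not_undercut q hq (hqu.sdiff_tautRules.mono hsub)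
      · exact hunsat (h'.finSat.mono hder)
    · exact h'.not_undercut r hr hu'
  · rintro Q hQ hQg ⟨r, hr | hr, hu⟩
    · refine (h.defended Q hQ hQg ⟨r, hr, hu⟩).imp ?_ ?_
      · rintro ⟨q, hq, hqu⟩
        exact ⟨q, hq, hqu.mono Set.subset_union_left⟩
      · exact mt fun h' => h'.mono fun φ =>
          Der.mono (Set.union_subset_union_left _ Set.subset_union_left)
    · refine (h'.defended Q hQ hQg ⟨r, hr, hu⟩).imp ?_ ?_
      · rintro ⟨q, hq, hqu⟩
        exact ⟨q, hq, hqu.mono Set.subset_union_right⟩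
      · exact mt fun h' => h'.mono fun φ =>
          Der.mono (Set.union_subset_union_left _ Set.subset_union_right)

/-- For the preferred conclusions, tautological rules are irrelevant. -/
theorem conclusions_preferredSemantics_sdiff_tautRules (AS : ArgSystem 𝓛) :
    (preferredSemantics 𝓛).conclusions AS =
      {T | ∃ R, Maximal (AS.Good (AS.Rd \ tautRules 𝓛)) R ∧ T = {φ | AS.Der R φ}} := by
  rw [conclusions_preferredSemantics]
  ext T
  constructor
  · rintro ⟨R, ⟨hR, hmax⟩, rfl⟩
    refine ⟨R \ tautRules 𝓛, ⟨hR.sdiff_tautRules, fun R' hR' hle r hr => ?_⟩,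
      (der_sdiff_tautRules R).symm⟩
    exact ⟨hmax (hR.union_of_sdiff_tautRules_subset hR'.of_sdiff_tautRules hle)
      Set.subset_union_left (Or.inr hr), (hR'.subset hr).2⟩
  · rintro ⟨R, ⟨hR, hmax⟩, rfl⟩
    obtain ⟨R', hle, hR'⟩ := hR.of_sdiff_tautRules.exists_maximal
    refine ⟨R', hR', ?_⟩
    have hle' : R ⊆ R' \ tautRules 𝓛 := fun r hr => ⟨hle hr, (hR.subset hr).2⟩
    rw [← der_sdiff_tautRules R', (hmax hR'.prop.sdiff_tautRules hle').antisymm hle']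

/-! ### Unions of syntactically disjoint systems -/

theorem IsUnion.symm (h : IsUnion AS₁ AS₂ AS) : IsUnion AS₂ AS₁ AS where
  AX_eq := h.AX_eq.trans (Set.union_comm _ _)
  Rd_eq := h.Rd_eq.trans (Set.union_comm _ _)
  name_iff r φ := (h.name_iff r φ).trans or_comm
  le_left := h.le_right
  le_right := h.le_left

theorem SynDisjoint.symm (h : AS₁.SynDisjoint AS₂) : AS₂.SynDisjoint AS₁ :=
  fun φ hφ ψ hψ => (Set.inter_comm _ _).trans (h ψ hψ φ hφ)

theorem atoms_subset_of_mem_AX {φ : F} (h : φ ∈ AS.AX) : 𝓛.atoms φ ⊆ AS.atoms := fun _ hp =>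
  Or.inl (Or.inr (Set.mem_iUnion₂.2 ⟨φ, h, hp⟩))

theorem ruleAtoms_subset {r : Rule F} (h : r ∈ AS.Rd) : ruleAtoms 𝓛 r ⊆ AS.atoms := fun _ hp =>
  Or.inl (Or.inl (Set.mem_iUnion₂.2 ⟨r, h, hp⟩))

theorem atoms_premise_subset {r : Rule F} (h : r ∈ AS.Rd) {φ : F} (hφ : φ ∈ r.premises) :
    𝓛.atoms φ ⊆ AS.atoms := fun _ hp =>
  ruleAtoms_subset h (Or.inl (Set.mem_iUnion₂.2 ⟨φ, hφ, hp⟩))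

theorem atoms_concl_subset {r : Rule F} (h : r ∈ AS.Rd) : 𝓛.atoms r.concl ⊆ AS.atoms :=
  fun _ hp => ruleAtoms_subset h (Or.inr hp)

theorem atoms_name_subset {r : Rule F} {φ : F} (h : AS.name r = some φ) :
    𝓛.atoms φ ⊆ AS.atoms := fun _ hp =>
  Or.inr (Set.mem_iUnion.2 ⟨r, Set.mem_iUnion₂.2 ⟨φ, h, hp⟩⟩)

theorem atoms_subset_of_mem_base {R : Set (Rule F)} (hR : R ⊆ AS.Rd) {φ : F}
    (h : φ ∈ AS.base R) : 𝓛.atoms φ ⊆ AS.atoms := by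
  rcases h with h | ⟨r, hr, -, rfl⟩
  · exact atoms_subset_of_mem_AX h
  · exact atoms_concl_subset (hR hr)

theorem atoms_of_mem_atoms {p : F} (hp : p ∈ AS.atoms) : 𝓛.atoms p = {p} := by
  simp only [atoms, ruleAtoms, Set.mem_union, Set.mem_iUnion] at hp
  obtain (⟨r, -, ⟨φ, -, hp⟩ | hp⟩ | ⟨φ, -, hp⟩) | ⟨r, φ, -, hp⟩ := hp
  all_goals exact 𝓛.atoms_atom _ p hp

/-- A common atom would share itself with itself, being its own only atom. -/
theorem SynDisjoint.disjoint (h : AS₁.SynDisjoint AS₂) : Disjoint AS₁.atoms AS₂.atoms := by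
  refine Set.disjoint_left.2 fun p hp₁ hp₂ => ?_
  have := h p hp₁ p hp₂
  simp [atoms_of_mem_atoms hp₁] at this

theorem SynDisjoint.of_atoms_subset (h : AS₁.SynDisjoint AS₂) {Γ Δ : Set F}
    (hΓ : ∀ φ ∈ Γ, 𝓛.atoms φ ⊆ AS₁.atoms) (hΔ : ∀ φ ∈ Δ, 𝓛.atoms φ ⊆ AS₂.atoms) :
    𝓛.SynDisjoint Γ Δ := fun φ hφ ψ hψ =>
  Set.disjoint_iff_inter_eq_empty.1 (h.disjoint.mono (hΓ φ hφ) (hΔ ψ hψ))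

/-- A common rule of syntactically disjoint systems whose conclusion is satisfiable is
tautological. -/
theorem SynDisjoint.mem_tautRules (h : AS₁.SynDisjoint AS₂) {r : Rule F} (h₁ : r ∈ AS₁.Rd)
    (h₂ : r ∈ AS₂.Rd) (hsat : ∃ i, 𝓛.models i r.concl) : r ∈ tautRules 𝓛 :=
  tautology_of_atoms_eq_empty (Set.subset_empty_iff.1
    (h.disjoint (atoms_concl_subset h₁) (atoms_concl_subset h₂))) hsat

/-! ### Splitting derivations in a union -/

theorem IsUnion.der_left (h : IsUnion AS₁ AS₂ AS) {R : Set (Rule F)} {φ : F}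
    (hφ : AS₁.Der R φ) : AS.Der R φ := by
  induction hφ with
  | ax hφ => exact .ax (h.AX_eq ▸ Or.inl hφ)
  | entails Γ hfin _ h ih => exact .entails Γ hfin ih h
  | rule r hr _ ih => exact .rule r hr ih

theorem IsUnion.grounded_left (h : IsUnion AS₁ AS₂ AS) {R : Set (Rule F)}
    (hR : AS₁.Grounded R) : AS.Grounded R := fun r hr φ hφ => h.der_left (hR r hr φ hφ)

theorem IsUnion.ruleUndercut_left (h : IsUnion AS₁ AS₂ AS) {R : Set (Rule F)} {r : Rule F}
    (hr : AS₁.RuleUndercut R r) : AS.RuleUndercut R r := by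
  obtain ⟨ν, hν, φ, hφ, hop⟩ := hr
  exact ⟨ν, (h.name_iff r ν).2 (Or.inl hν), φ, h.der_left hφ, hop⟩

/-- The pieces of a consistent derivation in the union of two disjoint systems that belong to the
first system can be carried out in this system. -/
theorem SynDisjoint.entails_left (hd : AS₁.SynDisjoint AS₂) {R₁ R₂ : Set (Rule F)}
    (hR₁ : R₁ ⊆ AS₁.Rd) (hR₂ : R₂ ⊆ AS₂.Rd) (hsat : 𝓛.FinSat {φ | AS₂.Der R₂ φ}) {φ : F}
    (hφ : 𝓛.FinEntails (AS₁.base R₁ ∪ AS₂.base R₂) φ) (hat : 𝓛.atoms φ ⊆ AS₁.atoms) :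
    AS₁.Der R₁ φ := by
  obtain ⟨Θ, hΘ, hfin, hent⟩ := hφ
  have hΘ₁ : ∀ ψ ∈ Θ ∩ AS₁.base R₁, AS₁.Der R₁ ψ := fun ψ hψ => .base hψ.2
  refine .entails (Θ ∩ AS₁.base R₁) (hfin.inter_of_left _) hΘ₁ ?_
  refine Entails.of_union (Δ := Θ ∩ AS₂.base R₂) ?_ ?_ (hd.of_atoms_subset ?_ ?_)
  · rwa [← Set.inter_union_distrib_left, Set.inter_eq_left.2 hΘ]
  · exact hsat _ (fun ψ hψ => .base hψ.2) (hfin.inter_of_left _)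
  · rintro ψ (rfl | hψ)
    · exact hat
    · exact atoms_subset_of_mem_base hR₁ hψ.2
  · exact fun ψ hψ => atoms_subset_of_mem_base hR₂ hψ.2

/-- By induction on the derivation. A premise of a rule of one system mentions only atoms of that
system, so the consistent base of the other can be dropped and the rule is applicable within its own
system. -/
theorem IsUnion.finEntails (h : IsUnion AS₁ AS₂ AS) (hd : AS₁.SynDisjoint AS₂)
    {R₁ R₂ : Set (Rule F)} (hR₁ : R₁ ⊆ AS₁.Rd) (hR₂ : R₂ ⊆ AS₂.Rd)
    (hsat₁ : 𝓛.FinSat {φ | AS₁.Der R₁ φ}) (hsat₂ : 𝓛.FinSat {φ | AS₂.Der R₂ φ}) {φ : F}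
    (hφ : AS.Der (R₁ ∪ R₂) φ) : 𝓛.FinEntails (AS₁.base R₁ ∪ AS₂.base R₂) φ := by
  induction hφ with
  | ax hφ =>
    rw [h.AX_eq] at hφ
    exact .of_mem (hφ.imp Or.inl Or.inl)
  | entails Γ hfin _ h ih => exact .trans hfin ih h
  | rule r hr _ ih =>
    rcases hr with hr | hr
    · exact .of_mem (Or.inl (Or.inr ⟨r, hr, fun ψ hψ => hd.entails_left hR₁ hR₂ hsat₂ (ih ψ hψ)
        (atoms_premise_subset (hR₁ hr) hψ), rfl⟩))
    · exact .of_mem (Or.inr (Or.inr ⟨r, hr, fun ψ hψ => hd.symm.entails_left hR₂ hR₁ hsat₁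
        (Set.union_comm _ _ ▸ ih ψ hψ) (atoms_premise_subset (hR₂ hr) hψ), rfl⟩))

theorem IsUnion.der_of_atoms_subset (h : IsUnion AS₁ AS₂ AS) (hd : AS₁.SynDisjoint AS₂)
    {R₁ R₂ : Set (Rule F)} (hR₁ : R₁ ⊆ AS₁.Rd) (hR₂ : R₂ ⊆ AS₂.Rd)
    (hsat₁ : 𝓛.FinSat {φ | AS₁.Der R₁ φ}) (hsat₂ : 𝓛.FinSat {φ | AS₂.Der R₂ φ}) {φ : F}
    (hφ : AS.Der (R₁ ∪ R₂) φ) (hat : 𝓛.atoms φ ⊆ AS₁.atoms) : AS₁.Der R₁ φ :=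
  hd.entails_left hR₁ hR₂ hsat₂ (h.finEntails hd hR₁ hR₂ hsat₁ hsat₂ hφ) hat

theorem IsUnion.finSat (h : IsUnion AS₁ AS₂ AS) (hd : AS₁.SynDisjoint AS₂)
    {R₁ R₂ : Set (Rule F)} (hR₁ : R₁ ⊆ AS₁.Rd) (hR₂ : R₂ ⊆ AS₂.Rd)
    (hsat₁ : 𝓛.FinSat {φ | AS₁.Der R₁ φ}) (hsat₂ : 𝓛.FinSat {φ | AS₂.Der R₂ φ}) :
    𝓛.FinSat {φ | AS.Der (R₁ ∪ R₂) φ} := by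
  refine FinSat.of_finEntails (Γ := AS₁.base R₁ ∪ AS₂.base R₂) (fun Θ hΘ hfin => ?_)
    fun φ hφ => h.finEntails hd hR₁ hR₂ hsat₁ hsat₂ hφ
  obtain ⟨i, hi₁, hi₂⟩ := 𝓛.joint_sat (Θ ∩ AS₁.base R₁) (Θ ∩ AS₂.base R₂)
    (hd.of_atoms_subset (fun ψ hψ => atoms_subset_of_mem_base hR₁ hψ.2)
      fun ψ hψ => atoms_subset_of_mem_base hR₂ hψ.2)
    (hsat₁ _ (fun ψ hψ => .base hψ.2) (hfin.inter_of_left _))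
    (hsat₂ _ (fun ψ hψ => .base hψ.2) (hfin.inter_of_left _))
  exact ⟨i, fun ψ hψ => (hΘ hψ).elim (fun h => hi₁ ψ ⟨hψ, h⟩) fun h => hi₂ ψ ⟨hψ, h⟩⟩

/-- As `r` is no rule of `AS₂`, its name comes from `AS₁`, so the undercutting formula is over the
atoms of `AS₁`. -/
theorem IsUnion.ruleUndercut_of_not_mem (h : IsUnion AS₁ AS₂ AS) (hd : AS₁.SynDisjoint AS₂)
    {R₁ R₂ : Set (Rule F)} (hR₁ : R₁ ⊆ AS₁.Rd) (hR₂ : R₂ ⊆ AS₂.Rd)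
    (hsat₁ : 𝓛.FinSat {φ | AS₁.Der R₁ φ}) (hsat₂ : 𝓛.FinSat {φ | AS₂.Der R₂ φ}) {r : Rule F}
    (hr : r ∉ AS₂.Rd) (hu : AS.RuleUndercut (R₁ ∪ R₂) r) : AS₁.RuleUndercut R₁ r := by
  obtain ⟨ν, hν, φ, hφ, hop⟩ := hu
  have hν₁ := ((h.name_iff r ν).1 hν).resolve_right fun h' => hr (AS₂.name_dom r ν h')
  exact ⟨ν, hν₁, φ, h.der_of_atoms_subset hd hR₁ hR₂ hsat₁ hsat₂ hφ
    (hop.atoms_eq ▸ atoms_name_subset hν₁), hop⟩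

theorem IsUnion.inter_union_inter (h : IsUnion AS₁ AS₂ AS) {R : Set (Rule F)} (hR : R ⊆ AS.Rd) :
    R ∩ AS₁.Rd ∪ R ∩ AS₂.Rd = R := by
  rw [← Set.inter_union_distrib_left, ← h.Rd_eq, Set.inter_eq_left.2 hR]

theorem IsUnion.finSat_inter (h : IsUnion AS₁ AS₂ AS) {R : Set (Rule F)}
    (hsat : 𝓛.FinSat {φ | AS.Der R φ}) : 𝓛.FinSat {φ | AS₁.Der (R ∩ AS₁.Rd) φ} :=
  hsat.mono fun _ hψ => (h.der_left hψ).mono Set.inter_subset_left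

theorem IsUnion.der_inter (h : IsUnion AS₁ AS₂ AS) (hd : AS₁.SynDisjoint AS₂)
    {R : Set (Rule F)} (hR : R ⊆ AS.Rd) (hsat : 𝓛.FinSat {φ | AS.Der R φ}) {φ : F}
    (hφ : AS.Der R φ) (hat : 𝓛.atoms φ ⊆ AS₁.atoms) : AS₁.Der (R ∩ AS₁.Rd) φ :=
  h.der_of_atoms_subset hd Set.inter_subset_right Set.inter_subset_right
    (h.finSat_inter hsat) (h.symm.finSat_inter hsat) ((h.inter_union_inter hR).symm ▸ hφ) hat

theorem IsUnion.grounded_inter (h : IsUnion AS₁ AS₂ AS) (hd : AS₁.SynDisjoint AS₂)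
    {R : Set (Rule F)} (hR : R ⊆ AS.Rd) (hsat : 𝓛.FinSat {φ | AS.Der R φ})
    (hg : AS.Grounded R) : AS₁.Grounded (R ∩ AS₁.Rd) := fun r hr φ hφ =>
  h.der_inter hd hR hsat (hg r hr.1 φ hφ) (atoms_premise_subset hr.2 hφ)

theorem IsUnion.ruleUndercut_inter (h : IsUnion AS₁ AS₂ AS) (hd : AS₁.SynDisjoint AS₂)
    {R : Set (Rule F)} (hR : R ⊆ AS.Rd) (hsat : 𝓛.FinSat {φ | AS.Der R φ}) {r : Rule F}
    (hr : r ∉ AS₂.Rd) (hu : AS.RuleUndercut R r) : AS₁.RuleUndercut (R ∩ AS₁.Rd) r :=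
  h.ruleUndercut_of_not_mem hd Set.inter_subset_right Set.inter_subset_right
    (h.finSat_inter hsat) (h.symm.finSat_inter hsat) hr ((h.inter_union_inter hR).symm ▸ hu)

/-- Non-tautological applicable rules of consistent sets belong to only one of two disjoint
systems. -/
theorem SynDisjoint.not_mem_right (hd : AS₁.SynDisjoint AS₂) {R : Set (Rule F)} {r : Rule F}
    (hr : r ∈ AS₁.Rd \ tautRules 𝓛) (hder : AS₁.Der R r.concl)
    (hsat : 𝓛.FinSat {φ | AS₁.Der R φ}) : r ∉ AS₂.Rd := fun hr₂ =>
  hr.2 (hd.mem_tautRules hr.1 hr₂ ((hsat {r.concl} (by simpa using hder)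
    (Set.finite_singleton _)).imp fun _ hi => hi _ rfl))

/-! ### Composing and decomposing good sets in a union -/

theorem Good.not_mem_right (hd : AS₁.SynDisjoint AS₂) {R : Set (Rule F)}
    (hR : AS₁.Good (AS₁.Rd \ tautRules 𝓛) R) {r : Rule F} (hr : r ∈ R) : r ∉ AS₂.Rd :=
  hd.not_mem_right (hR.subset hr) (.rule r hr (hR.grounded r hr)) hR.finSat

/-- If `R ∪ Q` is consistent, the undercut is already due to the part of `Q` in `AS₁`, against which
`R` is defended there. -/
theorem Good.defended_isUnion (hd : AS₁.SynDisjoint AS₂) (h : IsUnion AS₁ AS₂ AS)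
    {R : Set (Rule F)} (hR : AS₁.Good (AS₁.Rd \ tautRules 𝓛) R) {Q : Set (Rule F)}
    (hQ : Q ⊆ AS.Rd \ tautRules 𝓛) (hQg : AS.Grounded Q) {r : Rule F} (hr : r ∈ R)
    (hu : AS.RuleUndercut Q r) :
    (∃ q ∈ Q, AS.RuleUndercut R q) ∨ ¬ 𝓛.FinSat {φ | AS.Der (R ∪ Q) φ} := by
  by_cases hsat : 𝓛.FinSat {φ | AS.Der (R ∪ Q) φ}
  swap
  · exact Or.inr hsat
  have hQR : Q ⊆ AS.Rd := hQ.trans Set.sdiff_subset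
  have hsatQ : 𝓛.FinSat {φ | AS.Der Q φ} := hsat.mono fun φ => Der.mono Set.subset_union_right
  rcases hR.defended (Q ∩ AS₁.Rd) (fun q hq => ⟨hq.2, (hQ hq.1).2⟩)
    (h.grounded_inter hd hQR hsatQ hQg)
    ⟨r, hr, h.ruleUndercut_inter hd hQR hsatQ (hR.not_mem_right hd hr) hu⟩ with
    ⟨q, hq, hqu⟩ | hunsat
  · exact Or.inl ⟨q, hq.1, h.ruleUndercut_left hqu⟩
  · exact (hunsat (hsat.mono fun φ hφ => (h.der_left hφ).mono
      (Set.union_subset_union_right _ Set.inter_subset_left))).elim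

theorem Good.union_isUnion (hd : AS₁.SynDisjoint AS₂) (h : IsUnion AS₁ AS₂ AS)
    {R₁ R₂ : Set (Rule F)} (hR₁ : AS₁.Good (AS₁.Rd \ tautRules 𝓛) R₁)
    (hR₂ : AS₂.Good (AS₂.Rd \ tautRules 𝓛) R₂) :
    AS.Good (AS.Rd \ tautRules 𝓛) (R₁ ∪ R₂) where
  subset := by
    rw [h.Rd_eq, Set.union_sdiff_distrib]
    exact Set.union_subset_union hR₁.subset hR₂.subset
  grounded := (h.grounded_left hR₁.grounded).union (h.symm.grounded_left hR₂.grounded)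
  finSat := h.finSat hd (hR₁.subset.trans Set.sdiff_subset) (hR₂.subset.trans Set.sdiff_subset)
    hR₁.finSat hR₂.finSat
  not_undercut := by
    have hsub₁ := hR₁.subset.trans Set.sdiff_subset
    have hsub₂ := hR₂.subset.trans Set.sdiff_subset
    rintro r (hr | hr) hu
    · exact hR₁.not_undercut r hr (h.ruleUndercut_of_not_mem hd hsub₁ hsub₂ hR₁.finSat hR₂.finSat
        (hR₁.not_mem_right hd hr) hu)
    · exact hR₂.not_undercut r hr (h.symm.ruleUndercut_of_not_mem hd.symm hsub₂ hsub₁ hR₂.finSat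
        hR₁.finSat (hR₂.not_mem_right hd.symm hr) (Set.union_comm _ _ ▸ hu))
  defended := by
    rintro Q hQ hQg ⟨r, hr | hr, hu⟩
    · refine (hR₁.defended_isUnion hd h hQ hQg hr hu).imp ?_ ?_
      · rintro ⟨q, hq, hqu⟩
        exact ⟨q, hq, hqu.mono Set.subset_union_left⟩
      · exact mt fun h' => h'.mono fun φ =>
          Der.mono (Set.union_subset_union_left _ Set.subset_union_left)
    · refine (hR₂.defended_isUnion hd.symm h.symm hQ hQg hr hu).imp ?_ ?_
      · rintro ⟨q, hq, hqu⟩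
        exact ⟨q, hq, hqu.mono Set.subset_union_right⟩
      · exact mt fun h' => h'.mono fun φ =>
          Der.mono (Set.union_subset_union_left _ Set.subset_union_right)

theorem Good.inter_isUnion (hd : AS₁.SynDisjoint AS₂) (h : IsUnion AS₁ AS₂ AS)
    {R : Set (Rule F)} (hR : AS.Good (AS.Rd \ tautRules 𝓛) R) :
    AS₁.Good (AS₁.Rd \ tautRules 𝓛) (R ∩ AS₁.Rd) where
  subset := fun _ hr => ⟨hr.2, (hR.subset hr.1).2⟩
  grounded := h.grounded_inter hd (hR.subset.trans Set.sdiff_subset) hR.finSat hR.grounded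
  finSat := h.finSat_inter hR.finSat
  not_undercut r hr hu :=
    hR.not_undercut r hr.1 ((h.ruleUndercut_left hu).mono Set.inter_subset_left)
  defended := by
    rintro Q hQ hQg ⟨r, hr, hu⟩
    by_cases hsat : 𝓛.FinSat {φ | AS₁.Der (R ∩ AS₁.Rd ∪ Q) φ}
    swap
    · exact Or.inr hsat
    have hRR : R ⊆ AS.Rd := hR.subset.trans Set.sdiff_subset
    have hQR : Q ⊆ AS.Rd \ tautRules 𝓛 := hQ.trans (Set.sdiff_subset_sdiff_left
      (h.Rd_eq ▸ Set.subset_union_left))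
    rcases hR.defended Q hQR (h.grounded_left hQg) ⟨r, hr.1, h.ruleUndercut_left hu⟩ with
      ⟨q, hq, hqu⟩ | hunsat
    · refine Or.inl ⟨q, hq, h.ruleUndercut_inter hd hRR hR.finSat ?_ hqu⟩
      -- Consistency with `Q`, assumed in this case, ensures that `q` is not shared with `AS₂`.
      exact hd.not_mem_right (hQ hq) (.rule q (Or.inr hq) fun φ hφ =>
        (hQg q hq φ hφ).mono Set.subset_union_right) hsat
    -- Each component being consistent, `R ∪ Q` would be consistent in the union.
    · refine (hunsat ((h.finSat hd (R₁ := R ∩ AS₁.Rd ∪ Q) (R₂ := R ∩ AS₂.Rd)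
        (Set.union_subset Set.inter_subset_right (hQ.trans Set.sdiff_subset))
        Set.inter_subset_right hsat (h.symm.finSat_inter hR.finSat)).mono fun φ =>
          Der.mono ?_)).elim
      rw [Set.union_right_comm, h.inter_union_inter hRR]

/-! ### Non-interference and crash-resistance -/

theorem IsUnion.restrict_conclusions_eq (h : IsUnion AS₁ AS₂ AS) (hd : AS₁.SynDisjoint AS₂) :
    𝓛.restrict ((preferredSemantics 𝓛).conclusions AS₁) AS₁.atoms =
      𝓛.restrict ((preferredSemantics 𝓛).conclusions AS) AS₁.atoms := by
  have key : ∀ R, AS.Good (AS.Rd \ tautRules 𝓛) R →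
      {φ ∈ {φ | AS₁.Der (R ∩ AS₁.Rd) φ} | 𝓛.atoms φ ⊆ AS₁.atoms} =
        {φ ∈ {φ | AS.Der R φ} | 𝓛.atoms φ ⊆ AS₁.atoms} := fun R hR =>
    Set.ext fun φ => and_congr_left fun hφ =>
      ⟨fun h' => (h.der_left h').mono Set.inter_subset_left,
        fun h' => h.der_inter hd (hR.subset.trans Set.sdiff_subset) hR.finSat h' hφ⟩
  simp only [conclusions_preferredSemantics_sdiff_tautRules]
  ext T
  constructor
  · rintro ⟨_, ⟨R₁, hR₁, rfl⟩, rfl⟩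
    obtain ⟨R, hle, hR⟩ := (hR₁.prop.union_isUnion hd h (good_empty _)).exists_maximal
    rw [Set.union_empty] at hle
    have heq : R₁ = R ∩ AS₁.Rd := hR₁.eq_of_le (hR.prop.inter_isUnion hd h)
      (Set.subset_inter hle (hR₁.prop.subset.trans Set.sdiff_subset))
    exact ⟨_, ⟨R, hR, rfl⟩, heq ▸ key R hR.prop⟩
  · rintro ⟨_, ⟨R, hR, rfl⟩, rfl⟩
    obtain ⟨R₁, hle, hR₁⟩ := (hR.prop.inter_isUnion hd h).exists_maximal
    have hRR : R ⊆ AS.Rd := hR.prop.subset.trans Set.sdiff_subset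
    -- Replacing the first component of `R` by `R₁` gives a good set containing `R`, so maximality
    -- applies.
    have hR₁R : R₁ ⊆ R := by
      refine Set.subset_union_left.trans (hR.le_of_ge
        (hR₁.prop.union_isUnion hd h (hR.prop.inter_isUnion hd.symm h.symm)) ?_)
      nth_rw 1 [← h.inter_union_inter hRR]
      exact Set.union_subset_union_left _ hle
    have heq : R₁ = R ∩ AS₁.Rd := Set.Subset.antisymm
      (Set.subset_inter hR₁R (hR₁.prop.subset.trans Set.sdiff_subset)) hle
    exact ⟨_, ⟨R₁, hR₁, rfl⟩, heq ▸ (key R hR.prop).symm⟩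

/-- A satisfiable formula over a new atom can be added as an axiom. -/
theorem exists_isUnion_axiom (AS₁ : ArgSystem 𝓛) {p χ : F} (hp : p ∉ AS₁.atoms)
    (hχ : 𝓛.atoms χ = {p}) (hsat : ∃ i, 𝓛.models i χ) :
    ∃ AS₂ AS : ArgSystem 𝓛, AS₁.SynDisjoint AS₂ ∧ IsUnion AS₁ AS₂ AS ∧ χ ∈ AS.AX := by
  have hpp : 𝓛.atoms p = {p} := 𝓛.atoms_atom χ p (by simp [hχ])
  refine ⟨{ AX := {χ}, AX_sat := by simpa [Satisfiable] using hsat, Rd := ∅, name := fun _ => none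
            name_dom := by simp, le := fun _ _ => False, le_dom := by simp, le_total := by simp
            le_trans := by simp },
    { AX := AS₁.AX ∪ {χ}, AX_sat := ?_, Rd := AS₁.Rd, name := AS₁.name
      name_dom := AS₁.name_dom, le := AS₁.le, le_dom := AS₁.le_dom, le_total := AS₁.le_total
      le_trans := AS₁.le_trans }, ?_, ?_, Or.inr rfl⟩
  · obtain ⟨i, h₁, h₂⟩ := 𝓛.joint_sat AS₁.AX {χ}
      (by
        rintro φ hφ _ rfl
        rw [hχ, Set.inter_singleton_eq_empty]
        exact fun h => hp (atoms_subset_of_mem_AX hφ h))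
      AS₁.AX_sat (by simpa using hsat)
    exact ⟨i, fun φ hφ => hφ.elim (h₁ φ) (h₂ φ)⟩
  · intro φ hφ ψ hψ
    obtain rfl : ψ = p := by simpa [atoms, hχ] using hψ
    rw [atoms_of_mem_atoms hφ, hpp, Set.inter_singleton_eq_empty]
    rintro rfl
    exact hp hφ
  · constructor <;> simp

end ArgSystem

theorem nonInterference_preferredSemantics {F : Type u} {I : Type v} (𝓛 : LogicalLanguage F I) :
    (preferredSemantics 𝓛).NonInterference := fun _ _ _ hd h =>
  ⟨h.restrict_conclusions_eq hd, h.symm.restrict_conclusions_eq hd.symm⟩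

theorem crashResistance_preferredSemantics {F : Type u} {I : Type v} (𝓛 : LogicalLanguage F I) :
    (preferredSemantics 𝓛).CrashResistance := by
  rintro ⟨AS₁, hsub, hAS₁⟩
  obtain ⟨p, hp, hp₁⟩ := Set.exists_of_ssubset hsub
  obtain ⟨φ, hpφ⟩ := Set.mem_iUnion.1 hp
  have hpp := 𝓛.atoms_atom φ p hpφ
  have hmem : ∀ χ, 𝓛.atoms χ = {p} → (∃ i, 𝓛.models i χ) →
      ∀ T ∈ (preferredSemantics 𝓛).conclusions AS₁, χ ∈ T := by
    intro χ hχ hsat T hT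
    obtain ⟨AS₂, AS, hd, h, hax⟩ := AS₁.exists_isUnion_axiom hp₁ hχ hsat
    rw [hAS₁ AS₂ AS hd h, ArgSystem.conclusions_preferredSemantics] at hT
    obtain ⟨R, -, rfl⟩ := hT
    exact .ax hax
  obtain ⟨hsat, hsat'⟩ := 𝓛.atoms_contingent φ p hpφ
  obtain ⟨R, -, hR⟩ := (ArgSystem.good_empty (AS := AS₁) AS₁.Rd).exists_maximal
  have hT : {φ | AS₁.Der R φ} ∈ (preferredSemantics 𝓛).conclusions AS₁ := by
    rw [ArgSystem.conclusions_preferredSemantics]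
    exact ⟨R, hR, rfl⟩
  -- Contamination is used twice, with new axiom `p` and with new axiom `¬p`, on the same conclusion
  -- set of `AS₁`.
  obtain ⟨i, hi⟩ := hR.prop.finSat {p, 𝓛.neg p}
    (by
      rintro _ (rfl | rfl)
      · exact hmem _ hpp hsat _ hT
      · exact hmem _ ((𝓛.atoms_neg p).trans hpp) hsat' _ hT)
    (by simp)
  exact (𝓛.models_neg i p).1 (hi _ (by simp)) (hi _ (by simp))

end DeductiveASPIC

theorem mainTheorem3 {F : Type*} {I : Type*} (𝓛 : DeductiveASPIC.LogicalLanguage F I) :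
    (DeductiveASPIC.preferredSemantics 𝓛).NonInterference ∧
      (DeductiveASPIC.preferredSemantics 𝓛).CrashResistance :=
  ⟨DeductiveASPIC.nonInterference_preferredSemantics 𝓛,
    DeductiveASPIC.crashResistance_preferredSemantics 𝓛⟩
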